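/- Let $g$ be a smooth pseudo-Riemannian metric of arbitrary signature on $\mathbb{R}^m$ with its usual coordinates $x=(x_1,\dots,x_m)$ and coordinate frame $\partial_i=\partial_{x_i}$, let $\nabla$ be its Levi-Civita connection, and let $R(X,Y)=\nabla_X\nabla_Y-\nabla_Y\nabla_X-\nabla_{[X,Y]}$. Write $R_{i_1i_2i_3}{}^{k}{}_{;j_1\dots j_\nu}$ for the components of the $\nu$-th covariant derivative $\nabla^\nu R$ (with $k$ the component along $\partial_k$ of $R(\partial_{i_1},\partial_{i_2})\partial_{i_3}$ and $j_1,\dots,j_\nu$ the indices of differentiation). Suppose that $(\mathbb{R}^m,g)$ is a generalized plane wave manifold, i.e. for all $i,j$ $$\nabla_{\partial_i}\partial_j=\sum_{k>\max(i,j)}\Gamma_{ij}{}^k(x_1,\dots,x_{k-1})\,\partial_k .$$ Then: 1. $(\mathbb{R}^m,g)$ is complete (every geodesic defined on an open interval extends to a geodesic defined on $\mathbb{R}$) and strongly geodesically convex (for all $P,Q\in\mathbb{R}^m$ there is exactly one geodesic $\gamma:[0,1]\to\mathbb{R}^m$ with $\gamma(0)=P$ and $\gamma(1)=Q$). 2.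 For every $\nu\ge 0$ and all indices, $R_{i_1i_2i_3}{}^{k}{}_{;j_1\dots j_\nu}$ vanishes identically unless $k>\max(i_1,i_2,i_3,j_1,\dots,j_\nu)$, and it is a function of $x_1,\dots,x_{k-1}$ only. 3. $(\mathbb{R}^m,g)$ is nilpotent Osserman, nilpotent Ivanov–Petrova and nilpotent Szabó: for every tangent vector $\xi$ the Jacobi operator $J(\xi):y\mapsto R(y,\xi)\xi$ and the Szabó operator $\mathcal{S}(\xi):y\mapsto(\nabla_\xi R)(y,\xi)\xi$ satisfy $J(\xi)^m=0$ and $\mathcal{S}(\xi)^m=0$, and for every orthonormal basis $\{e_1,e_2\}$ of a spacelike or timelike tangent $2$-plane the operator $y\mapsto R(e_1,e_2)y$ has vanishing $m$-th power. 4. $(\mathbb{R}^m,g)$ is Ricci flat ($\rho_{ij}=\sum_kR_{kij}{}^k=0$) and Einstein ($\rho=c\,g$ for a constant $c$). 5. $(\mathbb{R}^m,g)$ is VSI: every scalar Weyl invariant vanishes identically, i.e. every full contraction of upper against lower indices in a product of at least one factor $R_{i_1i_2i_3}{}^{k}{}_{;j_1\dots j_\nu}$ ($\nu\ge0$ arbitrary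 for each factor) and any number of factors $g^{ij}$ and $g_{ij}$ is zero at every point. 6. If $\gamma:[0,1]\to\mathbb{R}^m$ is a smooth curve, then parallel transport along $\gamma$ is a well-defined linear isomorphism $P_\gamma:T_{\gamma(0)}\mathbb{R}^m\to T_{\gamma(1)}\mathbb{R}^m$, and for each $i$ there are real numbers $a^j$ with $P_\gamma\partial_i=\partial_i+\sum_{j>i}a^j\partial_j$. 7. The group $\mathcal{T}$ of real upper triangular $m\times m$ matrices with all diagonal entries $1$ is nilpotent, and for every point $P$ the holonomy group $\mathcal{H}_P$ (the group of the parallel transports along smooth loops at $P$) is contained in $\mathcal{T}$, where an automorphism $A$ of the tangent space is identified with the matrix $(T_{ij})$ given by $A\partial_i=\sum_jT_{ij}\partial_j$. -/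

import Mathlib

namespace GPW

open scoped ContDiff

noncomputable section

/-- The underlying space `ℝ^m` with its usual coordinates. Every tangent space is identified with
`ℝ^m` through the coordinate frame `∂_i`. -/
abbrev E (m : ℕ) : Type := Fin m → ℝ

/-- The coordinate vector `∂_i`. -/
def basisVec {m : ℕ} (i : Fin m) : E m := Pi.single i 1

/-- The partial derivative `∂_i f` at `x`. -/
def pd {m : ℕ} (i : Fin m) (f : E m → ℝ) (x : E m) : ℝ := fderiv ℝ f x (basisVec i)

/-- A smooth pseudo-Riemannian metric on `ℝ^m`, of arbitrary signature, through its components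
`g_{ij} = g(∂_i, ∂_j)`. -/
structure Metric (m : ℕ) where
  toMatrix : E m → Matrix (Fin m) (Fin m) ℝ
  smooth : ∀ i j, ContDiff ℝ ∞ (fun x => toMatrix x i j)
  symm : ∀ x, (toMatrix x).IsSymm
  nondeg : ∀ x, (toMatrix x).det ≠ 0

variable {m : ℕ}

/-- The inner product `g_x(u, v)`. -/
def Metric.inner (g : Metric m) (x u v : E m) : ℝ :=
  ∑ i, ∑ j, g.toMatrix x i j * u i * v j

/-- The Christoffel symbols of the Levi-Civita connection:
`∇_{∂_i} ∂_j = ∑ k, christoffel g i j k • ∂_k`. -/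
def christoffel (g : Metric m) (i j k : Fin m) (x : E m) : ℝ :=
  (1 / 2) * ∑ l, (g.toMatrix x)⁻¹ k l *
    (pd i (fun y => g.toMatrix y j l) x + pd j (fun y => g.toMatrix y i l) x
      - pd l (fun y => g.toMatrix y i j) x)

/-- `f` depends only on the coordinates `x_i` with `i < k`. -/
def DependsOnlyBelow (k : Fin m) (f : E m → ℝ) : Prop :=
  ∀ x y : E m, (∀ i, i < k → x i = y i) → f x = f y

/-- `∇_{∂_i} ∂_j = ∑_{k > max(i,j)} Γ_{ij}^k(x_1, …, x_{k-1}) ∂_k`. -/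
def IsGeneralizedPlaneWave (g : Metric m) : Prop :=
  ∀ i j k : Fin m,
    (k ≤ max i j → ∀ x, christoffel g i j k x = 0) ∧
    DependsOnlyBelow k (christoffel g i j k)

/-! ### Curves, geodesics, parallel transport -/

/-- The covariant derivative `∇_{γ'} X` of a vector field `X` along a curve `γ` with parameter
domain `s`. -/
def covDerivAlong (g : Metric m) (γ X : ℝ → E m) (s : Set ℝ) (t : ℝ) : E m := fun k =>
  derivWithin X s t k + ∑ i, ∑ j, christoffel g i j k (γ t) * derivWithin γ s t i * X t j

/-- `X` is a smooth parallel vector field along `γ`, with parameter domain `s`. -/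
def IsParallelOn (g : Metric m) (γ X : ℝ → E m) (s : Set ℝ) : Prop :=
  ContDiffOn ℝ ∞ X s ∧ ∀ t ∈ s, covDerivAlong g γ X s t = 0

/-- `γ` is a geodesic with parameter domain `s` (an open or a compact interval, or all of `ℝ`). -/
def IsGeodesicOn (g : Metric m) (γ : ℝ → E m) (s : Set ℝ) : Prop :=
  ContDiffOn ℝ ∞ γ s ∧ ∀ t ∈ s, covDerivAlong g γ (derivWithin γ s) s t = 0

/-- Every geodesic, defined on any open interval, extends to a geodesic defined on `ℝ`. -/
def IsComplete (g : Metric m) : Prop :=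
  ∀ (I : Set ℝ) (γ : ℝ → E m), IsOpen I → I.OrdConnected → IsGeodesicOn g γ I →
    ∃ γ' : ℝ → E m, IsGeodesicOn g γ' Set.univ ∧ Set.EqOn γ γ' I

/-- Any two points are joined by a unique geodesic `[0,1] → ℝ^m`. -/
def IsStronglyGeodesicallyConvex (g : Metric m) : Prop :=
  ∀ P Q : E m, ∃ γ : ℝ → E m,
    (IsGeodesicOn g γ (Set.Icc 0 1) ∧ γ 0 = P ∧ γ 1 = Q) ∧
    ∀ γ' : ℝ → E m, IsGeodesicOn g γ' (Set.Icc 0 1) → γ' 0 = P → γ' 1 = Q →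
      Set.EqOn γ' γ (Set.Icc 0 1)

/-- A smooth curve `γ : [0,1] → ℝ^m`. -/
def IsSmoothCurve (γ : ℝ → E m) : Prop := ContDiffOn ℝ ∞ γ (Set.Icc 0 1)

/-- `P` is the parallel transport `P_γ : T_{γ(0)} → T_{γ(1)}`: `P v = w` exactly if some parallel
vector field along `γ` takes the value `v` at `0` and the value `w` at `1`. -/
def IsParallelTransport (g : Metric m) (γ : ℝ → E m) (P : E m ≃ₗ[ℝ] E m) : Prop :=
  ∀ v w : E m,
    (∃ X : ℝ → E m, IsParallelOn g γ X (Set.Icc 0 1) ∧ X 0 = v ∧ X 1 = w) ↔ P v = w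

/-- The holonomy group at `p`, generated by the parallel transports along smooth loops at `p`. -/
def holonomyGroup (g : Metric m) (p : E m) : Subgroup (E m ≃ₗ[ℝ] E m) :=
  Subgroup.closure {P | ∃ γ : ℝ → E m, IsSmoothCurve γ ∧ γ 0 = p ∧ γ 1 = p ∧
    IsParallelTransport g γ P}

theorem unitri_mul {A B : Matrix (Fin m) (Fin m) ℝ}
    (hA : (∀ i j, j < i → A i j = 0) ∧ ∀ i, A i i = 1)
    (hB : (∀ i j, j < i → B i j = 0) ∧ ∀ i, B i i = 1) :
    (∀ i j, j < i → (A * B) i j = 0) ∧ ∀ i, (A * B) i i = 1 := by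
  have key : ∀ i j k, (j ≤ i) → k ≠ i → A i k * B k j = 0 := by
    intro i j k hji hk
    rcases lt_or_gt_of_ne hk with h | h
    · rw [hA.1 i k h, zero_mul]
    · rw [hB.1 k j (lt_of_le_of_lt hji h), mul_zero]
  constructor
  · intro i j h
    rw [Matrix.mul_apply, Finset.sum_eq_single i (fun k _ hk => key i j k h.le hk) (by simp),
      hB.1 i j h, mul_zero]
  · intro i
    rw [Matrix.mul_apply, Finset.sum_eq_single i (fun k _ hk => key i i k le_rfl hk) (by simp),
      hA.2, hB.2, mul_one]

theorem unitri_inv {A B : Matrix (Fin m) (Fin m) ℝ} (hAB : A * B = 1) (hBA : B * A = 1)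
    (hA : (∀ i j, j < i → A i j = 0) ∧ ∀ i, A i i = 1) :
    (∀ i j, j < i → B i j = 0) ∧ ∀ i, B i i = 1 := by
  have hB : B = A⁻¹ := (Matrix.inv_eq_right_inv hAB).symm
  let _ : Invertible A := ⟨B, hBA, hAB⟩
  have ht : Matrix.BlockTriangular B id := by
    rw [hB]
    exact Matrix.blockTriangular_inv_of_blockTriangular (fun i j h => hA.1 i j h)
  refine ⟨fun i j h => ht h, fun i => ?_⟩
  have h1 : (A * B) i i = 1 := by rw [hAB, Matrix.one_apply_eq]
  rw [Matrix.mul_apply, Finset.sum_eq_single i _ (by simp), hA.2, one_mul] at h1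
  · exact h1
  · intro k _ hk
    rcases lt_or_gt_of_ne hk with h | h
    · rw [hA.1 i k h, zero_mul]
    · rw [ht h, mul_zero]

/-- The group `𝒯` of upper triangular matrices with all diagonal entries equal to `1`. -/
def upperUnipotent (m : ℕ) : Subgroup (GL (Fin m) ℝ) where
  carrier := {A | (∀ i j, j < i → A.val i j = 0) ∧ ∀ i, A.val i i = 1}
  mul_mem' := fun hA hB => unitri_mul hA hB
  one_mem' := ⟨fun _ _ h => Matrix.one_apply_ne h.ne', fun i => Matrix.one_apply_eq i⟩
  inv_mem' := fun {A} hA => unitri_inv A.val_inv A.inv_val hA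

/-! ### Curvature and its covariant derivatives -/

/-- The components `R_{ijk}^l` of the curvature operator, `R(∂_i, ∂_j) ∂_k = ∑ l, R_{ijk}^l ∂_l`,
where `R(X, Y) = ∇_X ∇_Y - ∇_Y ∇_X - ∇_{[X, Y]}`. -/
def curvature (g : Metric m) (i j k l : Fin m) (x : E m) : ℝ :=
  pd i (christoffel g j k l) x - pd j (christoffel g i k l) x
    + ∑ n, (christoffel g i n l x * christoffel g j k n x
      - christoffel g j n l x * christoffel g i k n x)

/-- The covariant derivative of a tensor field with `n` lower indices and one upper index, given by
its components `T I k`; the index of differentiation becomes the last lower index. -/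
def covDeriv {n : ℕ} (g : Metric m) (T : (Fin n → Fin m) → Fin m → E m → ℝ) :
    (Fin (n + 1) → Fin m) → Fin m → E m → ℝ := fun J k x =>
  let I : Fin n → Fin m := fun a => J a.castSucc
  let j : Fin m := J (Fin.last n)
  pd j (T I k) x
    - ∑ a, ∑ r, christoffel g j (I a) r x * T (Function.update I a r) k x
    + ∑ r, christoffel g j r k x * T I r x

/-- The components of `∇^ν R`: `nablaR g ν I k` is `R_{i₁ i₂ i₃}^k_{; j₁ … j_ν}`, where `I` lists
the lower indices `i₁, i₂, i₃` followed by the `ν` indices of differentiation. -/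
def nablaR (g : Metric m) : (ν : ℕ) → (Fin (3 + ν) → Fin m) → Fin m → E m → ℝ
  | 0 => fun I k => curvature g (I (0 : Fin 3)) (I (1 : Fin 3)) (I (2 : Fin 3)) k
  | ν + 1 => covDeriv g (nablaR g ν)

/-- The matrix of the Jacobi operator `J(ξ) : y ↦ R(y, ξ) ξ` at `x`; its `i`-th column holds the
components of the image of `∂_i`. -/
def jacobiOp (g : Metric m) (x ξ : E m) : Matrix (Fin m) (Fin m) ℝ :=
  Matrix.of fun l i => ∑ j, ∑ k, curvature g i j k l x * ξ j * ξ k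

/-- The matrix of the Szabó operator `S(ξ) : y ↦ (∇_ξ R)(y, ξ) ξ` at `x`. -/
def szaboOp (g : Metric m) (x ξ : E m) : Matrix (Fin m) (Fin m) ℝ :=
  Matrix.of fun l i => ∑ j, ∑ k, ∑ n, nablaR g 1 ![i, j, k, n] l x * ξ j * ξ k * ξ n

/-- The matrix of the curvature operator `y ↦ R(e₁, e₂) y` at `x`. -/
def curvatureOp (g : Metric m) (x e₁ e₂ : E m) : Matrix (Fin m) (Fin m) ℝ :=
  Matrix.of fun l k => ∑ i, ∑ j, curvature g i j k l x * e₁ i * e₂ j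

/-- `e₁, e₂` is an orthonormal basis of a spacelike or of a timelike 2-plane at `x`. -/
def IsOrthonormalPair (g : Metric m) (x e₁ e₂ : E m) : Prop :=
  g.inner x e₁ e₂ = 0 ∧
    ((g.inner x e₁ e₁ = 1 ∧ g.inner x e₂ e₂ = 1) ∨ (g.inner x e₁ e₁ = -1 ∧ g.inner x e₂ e₂ = -1))

def IsNilpotentOsserman (g : Metric m) : Prop :=
  ∀ x ξ : E m, jacobiOp g x ξ ^ m = 0

def IsNilpotentSzabo (g : Metric m) : Prop :=
  ∀ x ξ : E m, szaboOp g x ξ ^ m = 0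

def IsNilpotentIvanovPetrova (g : Metric m) : Prop :=
  ∀ x e₁ e₂ : E m, IsOrthonormalPair g x e₁ e₂ → curvatureOp g x e₁ e₂ ^ m = 0

/-- The Ricci tensor `ρ_{ij} = ∑ k, R_{kij}^k`. -/
def ricci (g : Metric m) (i j : Fin m) (x : E m) : ℝ := ∑ k, curvature g k i j k x

def IsRicciFlat (g : Metric m) : Prop := ∀ i j x, ricci g i j x = 0

def IsEinstein (g : Metric m) : Prop :=
  ∃ c : ℝ, ∀ i j x, ricci g i j x = c * g.toMatrix x i j

/-! ### Scalar Weyl invariants -/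

/-- A complete contraction of a product of at least one factor `R_{i₁i₂i₃}^{i₄}_{;j₁…j_ν}` with any
number of factors `g^{ij}` and `g_{ij}`, in which every lower index is paired with an upper one. -/
structure WeylMonomial where
  /-- the number of curvature factors -/
  numR : ℕ
  numR_pos : 0 < numR
  /-- the number of covariant derivatives in each curvature factor -/
  order : Fin numR → ℕ
  /-- the number of factors `g^{ij}` -/
  numInv : ℕ
  /-- the number of factors `g_{ij}` -/
  numMet : ℕ
  /-- the pairing of the lower index slots with the upper index slots -/
  pairing : ((s : Fin numR) × Fin (3 + order s)) ⊕ (Fin numMet × Fin 2) ≃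
    Fin numR ⊕ (Fin numInv × Fin 2)

/-- The value at `x`: the sum over all assignments `f` of coordinate indices to the upper slots
(hence, through the pairing, to the lower slots). -/
def WeylMonomial.eval (Θ : WeylMonomial) (g : Metric m) (x : E m) : ℝ :=
  ∑ f : Fin Θ.numR ⊕ (Fin Θ.numInv × Fin 2) → Fin m,
    (∏ s : Fin Θ.numR,
      nablaR g (Θ.order s) (fun a => f (Θ.pairing (Sum.inl ⟨s, a⟩))) (f (Sum.inl s)) x) *
    (∏ b : Fin Θ.numInv, (g.toMatrix x)⁻¹ (f (Sum.inr (b, 0))) (f (Sum.inr (b, 1)))) *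
    (∏ c : Fin Θ.numMet, g.toMatrix x (f (Θ.pairing (Sum.inr (c, 0))))
      (f (Θ.pairing (Sum.inr (c, 1)))))

/-- Vanishing scalar invariants. -/
def IsVSI (g : Metric m) : Prop := ∀ (Θ : WeylMonomial) (x : E m), Θ.eval g x = 0

end

end GPW

namespace GPW

open scoped ContDiff

variable {m : ℕ}

/-! Everything rests on a one-way dependence: an upper index exceeds every lower index, and a
component with upper index `k` only sees the coordinates before `x_k`. Products of Christoffel
symbols and partial derivatives keep this pattern (`IsTriangular.covDeriv`), so every `∇^ν R` has
it. The Jacobi, Szabó and curvature operators are then strictly triangular, and the Ricci trace is a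
sum of zeros.

The geodesic and parallel transport equations are likewise triangular: the right-hand side for the
`k`-th component involves only earlier components and is already known when that component is
reached. Each step is an ordinary integration, so solutions exist on the whole parameter interval
and are unique, for initial data as well as for two endpoints (`exists_triangular_family`,
`exists_isGeodesicOn`, `IsGeodesicOn.eqOn`). The same recursion shows that transport is
unitriangular.

Scalar invariants are the delicate point, since factors `g^{ij}` and `g_{ij}` need not respect the
order of indices. Two facts repair this. First, a unitriangular change of basis makes the metric at
a point monomial, supported on the graph of an involution `σ` (`exists_isUnitri_isMonomialOn`), and
such a change preserves triangularity. Second, `∇^ν R` is skew, with respect to `g`, in its third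
lower index and its upper index (`isSkewAt_nablaR`). A nonzero component with upper index `k` and
third lower index `i` thus satisfies both `i < k` and `σ k < σ i`. In a nonzero term of a
contraction, the largest element of the `σ`-closed set of curvature indices contradicts one of the
two inequalities (`WeylMonomial.contract_eq_zero`). -/

/-! ### Smoothness of the components and rules for partial derivatives -/

theorem contDiff_pd {f : E m → ℝ} (hf : ContDiff ℝ ∞ f) (i : Fin m) : ContDiff ℝ ∞ (pd i f) :=
  (hf.fderiv_right (m := ∞) (by simp)).clm_apply contDiff_const

theorem contDiff_det {ι : Type*} [Fintype ι] [DecidableEq ι] {A : E m → Matrix ι ι ℝ}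
    (hA : ∀ i j, ContDiff ℝ ∞ (fun x => A x i j)) : ContDiff ℝ ∞ (fun x => (A x).det) := by
  simp only [Matrix.det_apply]
  refine ContDiff.sum fun σ _ => ContDiff.const_smul _ ?_
  exact contDiff_prod fun i _ => hA _ _

theorem contDiff_metric_inv (g : Metric m) (i j : Fin m) :
    ContDiff ℝ ∞ (fun x => (g.toMatrix x)⁻¹ i j) := by
  have h1 : ContDiff ℝ ∞ (fun x => (g.toMatrix x).det) := contDiff_det g.smooth
  have h2 : ContDiff ℝ ∞ (fun x => (g.toMatrix x).adjugate i j) := by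
    simp only [Matrix.adjugate_apply]
    refine contDiff_det fun a b => ?_
    by_cases h : a = j
    · subst h
      simp only [Matrix.updateRow_self]
      exact contDiff_const
    · simp only [Matrix.updateRow_ne h]
      exact g.smooth a b
  simp only [Matrix.inv_def, Matrix.smul_apply, Ring.inverse_eq_inv', smul_eq_mul]
  exact (h1.inv g.nondeg).mul h2

theorem contDiff_christoffel (g : Metric m) (i j k : Fin m) :
    ContDiff ℝ ∞ (christoffel g i j k) := by
  unfold christoffel
  refine contDiff_const.mul (ContDiff.sum fun l _ => (contDiff_metric_inv g k l).mul ?_)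
  exact ((contDiff_pd (g.smooth _ _) _).add (contDiff_pd (g.smooth _ _) _)).sub
    (contDiff_pd (g.smooth _ _) _)

theorem contDiff_curvature (g : Metric m) (i j k l : Fin m) :
    ContDiff ℝ ∞ (curvature g i j k l) := by
  unfold curvature
  refine ((contDiff_pd (contDiff_christoffel g _ _ _) _).sub
    (contDiff_pd (contDiff_christoffel g _ _ _) _)).add (ContDiff.sum fun n _ => ?_)
  exact ((contDiff_christoffel g _ _ _).mul (contDiff_christoffel g _ _ _)).sub
    ((contDiff_christoffel g _ _ _).mul (contDiff_christoffel g _ _ _))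

theorem contDiff_covDeriv (g : Metric m) {n : ℕ} {T : (Fin n → Fin m) → Fin m → E m → ℝ}
    (hT : ∀ I k, ContDiff ℝ ∞ (T I k)) (J : Fin (n + 1) → Fin m) (k : Fin m) :
    ContDiff ℝ ∞ (covDeriv g T J k) := by
  unfold covDeriv
  refine ((contDiff_pd (hT _ _) _).sub (ContDiff.sum fun a _ => ContDiff.sum fun r _ => ?_)).add
    (ContDiff.sum fun r _ => ?_)
  · exact (contDiff_christoffel g _ _ _).mul (hT _ _)
  · exact (contDiff_christoffel g _ _ _).mul (hT _ _)

theorem contDiff_nablaR (g : Metric m) (ν : ℕ) :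
    ∀ (I : Fin (3 + ν) → Fin m) (k : Fin m), ContDiff ℝ ∞ (nablaR g ν I k) := by
  induction ν with
  | zero => exact fun I k => contDiff_curvature g _ _ _ _
  | succ ν ih => exact fun I k => contDiff_covDeriv g ih I k

theorem pd_add {f h : E m → ℝ} (hf : ContDiff ℝ ∞ f) (hh : ContDiff ℝ ∞ h) (i : Fin m) (x : E m) :
    pd i (fun y => f y + h y) x = pd i f x + pd i h x := by
  unfold pd
  rw [fderiv_fun_add (hf.differentiable (by simp) x) (hh.differentiable (by simp) x)]
  rfl

theorem pd_mul {f h : E m → ℝ} (hf : ContDiff ℝ ∞ f) (hh : ContDiff ℝ ∞ h) (i : Fin m) (x : E m) :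
    pd i (fun y => f y * h y) x = f x * pd i h x + h x * pd i f x := by
  unfold pd
  rw [fderiv_fun_mul (hf.differentiable (by simp) x) (hh.differentiable (by simp) x)]
  simp

theorem pd_sum {ι : Type*} (s : Finset ι) {f : ι → E m → ℝ} (hf : ∀ a, ContDiff ℝ ∞ (f a))
    (i : Fin m) (x : E m) : pd i (fun y => ∑ a ∈ s, f a y) x = ∑ a ∈ s, pd i (f a) x := by
  unfold pd
  rw [fderiv_fun_sum (fun a _ => (hf a).differentiable (by simp) x)]
  simp

theorem pd_const (c : ℝ) (i : Fin m) (x : E m) : pd i (fun _ => c) x = 0 := by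
  unfold pd
  simp

theorem pd_comm {f : E m → ℝ} (hf : ContDiff ℝ ∞ f) (i j : Fin m) (x : E m) :
    pd i (pd j f) x = pd j (pd i f) x := by
  have hd : DifferentiableAt ℝ (fderiv ℝ f) x :=
    (hf.fderiv_right (m := ∞) (by simp)).differentiable (by simp) x
  have key : ∀ a b : Fin m, pd a (pd b f) x = fderiv ℝ (fderiv ℝ f) x (basisVec a) (basisVec b) := by
    intro a b
    change fderiv ℝ (fun y => fderiv ℝ f y (basisVec b)) x (basisVec a) = _
    rw [fderiv_clm_apply hd (by fun_prop)]
    simp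
  rw [key, key]
  have hs : IsSymmSndFDerivAt ℝ f x := hf.contDiffAt.isSymmSndFDerivAt (by
    rw [minSmoothness_of_isRCLikeNormedField]; exact WithTop.coe_le_coe.2 (le_top : (2 : ℕ∞) ≤ ⊤))
  exact hs _ _

/-- The translates of `f` by `x` and by `y` are the same function when `x` and `y` agree below `k`,
hence have the same derivative at the origin. -/
theorem DependsOnlyBelow.pd {k : Fin m} {f : E m → ℝ} (hf : DependsOnlyBelow k f) (i : Fin m) :
    DependsOnlyBelow k (pd i f) := by
  intro x y hxy
  unfold GPW.pd
  have h : (fun z => f (z + x)) = fun z => f (z + y) := by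
    funext z
    exact hf _ _ fun j hj => by simp [hxy j hj]
  have h1 := fderiv_comp_add_right (𝕜 := ℝ) (f := f) (x := 0) x
  have h2 := fderiv_comp_add_right (𝕜 := ℝ) (f := f) (x := 0) y
  rw [h] at h1
  rw [zero_add] at h1 h2
  rw [← h1, ← h2]

theorem DependsOnlyBelow.pd_eq_zero {k : Fin m} {f : E m → ℝ} (hf : DependsOnlyBelow k f)
    (hs : ContDiff ℝ ∞ f) {i : Fin m} (hi : k ≤ i) (x : E m) : GPW.pd i f x = 0 := by
  unfold GPW.pd
  have hd := (hs.differentiable (by simp) x).hasFDerivAt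
  have h1 : HasDerivAt (fun t : ℝ => f (x + t • basisVec i)) (fderiv ℝ f x (basisVec i)) 0 := by
    have := hd.hasLineDerivAt (basisVec i)
    exact this
  have h2 : (fun t : ℝ => f (x + t • basisVec i)) = fun _ => f x := by
    funext t
    refine hf _ _ fun j hj => ?_
    have : j ≠ i := (lt_of_lt_of_le hj hi).ne
    simp [basisVec, Pi.single_eq_of_ne this]
  rw [h2] at h1
  exact h1.unique (hasDerivAt_const _ _)

/-! ### Triangularity of the curvature and of its covariant derivatives -/

/-- A tensor with one upper index whose components `T I k` vanish unless `k` exceeds all the lower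
indices, and depend only on the coordinates below `k`. -/
def IsTriangular {n : ℕ} (T : (Fin n → Fin m) → Fin m → E m → ℝ) : Prop :=
  ∀ I k, ((∃ a, k ≤ I a) → ∀ x, T I k x = 0) ∧ DependsOnlyBelow k (T I k)

theorem DependsOnlyBelow.mono {j k : Fin m} {f : E m → ℝ} (hf : DependsOnlyBelow j f) (h : j ≤ k) :
    DependsOnlyBelow k f :=
  fun x y hxy => hf x y fun i hi => hxy i (lt_of_lt_of_le hi h)

theorem IsGeneralizedPlaneWave.christoffel_eq_zero {g : Metric m} (hg : IsGeneralizedPlaneWave g)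
    {i j k : Fin m} (h : k ≤ i ∨ k ≤ j) (x : E m) : christoffel g i j k x = 0 :=
  (hg i j k).1 (le_max_iff.2 h) x

theorem IsGeneralizedPlaneWave.pd_christoffel_eq_zero {g : Metric m}
    (hg : IsGeneralizedPlaneWave g) {i j k n : Fin m} (h : k ≤ n ∨ k ≤ i ∨ k ≤ j) (x : E m) :
    pd n (christoffel g i j k) x = 0 := by
  rcases h with h | h
  · exact (hg i j k).2.pd_eq_zero (contDiff_christoffel g i j k) h x
  · have : christoffel g i j k = fun _ => 0 := funext fun y => hg.christoffel_eq_zero h y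
    rw [this, pd_const]

theorem curvature_eq_zero {g : Metric m} (hg : IsGeneralizedPlaneWave g) {i j k l : Fin m}
    (h : l ≤ i ∨ l ≤ j ∨ l ≤ k) (x : E m) : curvature g i j k l x = 0 := by
  have h1 : pd i (christoffel g j k l) x = 0 := hg.pd_christoffel_eq_zero h x
  have h2 : pd j (christoffel g i k l) x = 0 := hg.pd_christoffel_eq_zero (by tauto) x
  -- A nonzero product forces `a < l` and `b, k < n < l`.
  have key : ∀ a b n : Fin m, (l ≤ a ∨ l ≤ b ∨ l ≤ k) →
      christoffel g a n l x * christoffel g b k n x = 0 := by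
    intro a b n hab
    by_cases h3 : l ≤ a ∨ l ≤ n
    · rw [hg.christoffel_eq_zero h3, zero_mul]
    · rw [hg.christoffel_eq_zero (i := b) (j := k) (k := n), mul_zero]
      push Not at h3
      rcases hab with h | h | h
      · exact absurd h (not_le.2 h3.1)
      · exact Or.inl (h3.2.le.trans h)
      · exact Or.inr (h3.2.le.trans h)
  unfold curvature
  rw [h1, h2, Finset.sum_eq_zero fun n _ => ?_]
  · simp
  · rw [key i j n h, key j i n (by tauto), sub_zero]

theorem dependsOnlyBelow_curvature {g : Metric m} (hg : IsGeneralizedPlaneWave g)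
    (i j k l : Fin m) : DependsOnlyBelow l (curvature g i j k l) := by
  intro x y hxy
  have key : ∀ a b n : Fin m, christoffel g a n l x * christoffel g b k n x =
      christoffel g a n l y * christoffel g b k n y := by
    intro a b n
    by_cases h : l ≤ n
    · rw [hg.christoffel_eq_zero (Or.inr h), hg.christoffel_eq_zero (Or.inr h), zero_mul, zero_mul]
    · rw [(hg a n l).2 x y hxy, ((hg b k n).2.mono (not_le.1 h).le) x y hxy]
  unfold curvature
  rw [((hg j k l).2.pd i) x y hxy, ((hg i k l).2.pd j) x y hxy]
  simp only [key]

/-- In a nonzero correction term the Christoffel symbol only replaces a lower index by a larger one,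
or the upper index by a smaller one. Either way the requirement on the tensor component gets
stricter, so the bound for the whole term survives. -/
theorem IsTriangular.covDeriv {g : Metric m} (hg : IsGeneralizedPlaneWave g) {n : ℕ}
    {T : (Fin n → Fin m) → Fin m → E m → ℝ} (hT : IsTriangular T)
    (hs : ∀ I k, ContDiff ℝ ∞ (T I k)) : IsTriangular (covDeriv g T) := by
  intro J k
  constructor
  · rintro ⟨c, hc⟩ x
    unfold GPW.covDeriv
    set I : Fin n → Fin m := fun a => J a.castSucc
    set j : Fin m := J (Fin.last n)
    have hc' : k ≤ j ∨ ∃ a, k ≤ I a := by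
      refine Fin.lastCases (motive := fun c => k ≤ J c → _) (fun h => Or.inl h)
        (fun a h => Or.inr ⟨a, h⟩) c hc
    have h1 : pd j (T I k) x = 0 := by
      rcases hc' with h | h
      · exact (hT I k).2.pd_eq_zero (hs I k) h x
      · have : T I k = fun _ => 0 := funext fun y => (hT I k).1 h y
        rw [this, pd_const]
    -- If the symbol is nonzero then `r` exceeds both `j` and `I a`, so any lower index that was at
    -- least `k` leaves one at least `k` after the update.
    have h2 : ∀ a r, christoffel g j (I a) r x * T (Function.update I a r) k x = 0 := by
      intro a r
      by_cases h3 : r ≤ j ∨ r ≤ I a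
      · rw [hg.christoffel_eq_zero h3, zero_mul]
      · rw [(hT (Function.update I a r) k).1 ?_ x, mul_zero]
        push Not at h3
        rcases hc' with h | ⟨b, h⟩
        · exact ⟨a, by simpa using h.trans h3.1.le⟩
        · by_cases hb : b = a
          · subst hb
            exact ⟨b, by simpa using h.trans h3.2.le⟩
          · exact ⟨b, by simpa [hb] using h⟩
    have h3 : ∀ r, christoffel g j r k x * T I r x = 0 := by
      intro r
      by_cases h4 : k ≤ j ∨ k ≤ r
      · rw [hg.christoffel_eq_zero h4, zero_mul]
      · push Not at h4
        rw [(hT I r).1 ?_ x, mul_zero]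
        rcases hc' with h | ⟨b, h⟩
        · exact absurd h (not_le.2 h4.1)
        · exact ⟨b, h4.2.le.trans h⟩
    simp [h1, h2, h3]
  · intro x y hxy
    unfold GPW.covDeriv
    set I : Fin n → Fin m := fun a => J a.castSucc
    set j : Fin m := J (Fin.last n)
    have h2 : ∀ a r, christoffel g j (I a) r x * T (Function.update I a r) k x =
        christoffel g j (I a) r y * T (Function.update I a r) k y := by
      intro a r
      by_cases h : k ≤ r
      · rw [(hT (Function.update I a r) k).1 ⟨a, by simpa using h⟩,
          (hT (Function.update I a r) k).1 ⟨a, by simpa using h⟩, mul_zero, mul_zero]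
      · rw [(hT _ k).2 x y hxy, ((hg j (I a) r).2.mono (not_le.1 h).le) x y hxy]
    have h3 : ∀ r, christoffel g j r k x * T I r x = christoffel g j r k y * T I r y := by
      intro r
      by_cases h : k ≤ r
      · rw [hg.christoffel_eq_zero (Or.inr h), hg.christoffel_eq_zero (Or.inr h), zero_mul,
          zero_mul]
      · rw [(hg j r k).2 x y hxy, ((hT I r).2.mono (not_le.1 h).le) x y hxy]
    simp only [h2, h3, ((hT I k).2.pd j) x y hxy]

theorem isTriangular_nablaR {g : Metric m} (hg : IsGeneralizedPlaneWave g) (ν : ℕ) :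
    IsTriangular (nablaR g ν) := by
  induction ν with
  | zero =>
    refine fun I k => ⟨fun ⟨a, ha⟩ x => curvature_eq_zero hg ?_ x,
      dependsOnlyBelow_curvature hg _ _ _ _⟩
    change Fin 3 at a
    fin_cases a
    · exact Or.inl ha
    · exact Or.inr (Or.inl ha)
    · exact Or.inr (Or.inr ha)
  | succ ν ih => exact ih.covDeriv hg (contDiff_nablaR g ν)

/-! ### Nilpotent operators and Ricci flatness -/

theorem pow_card_eq_zero_of_strictly_lower {A : Matrix (Fin m) (Fin m) ℝ}
    (hA : ∀ l i, l ≤ i → A l i = 0) : A ^ m = 0 := by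
  -- Each factor moves the support one subdiagonal further down; after `m` factors nothing is left.
  have key : ∀ (n : ℕ) (l i : Fin m), (l : ℕ) < i + n → (A ^ n) l i = 0 := by
    intro n
    induction n with
    | zero =>
      intro l i h
      rw [pow_zero, Matrix.one_apply_ne (by rintro rfl; omega)]
    | succ n ih =>
      intro l i h
      rw [pow_succ, Matrix.mul_apply]
      refine Finset.sum_eq_zero fun j _ => ?_
      by_cases hj : j ≤ i
      · rw [hA j i hj, mul_zero]
      · rw [ih l j (by have : (i : ℕ) < j := not_le.1 hj; omega), zero_mul]
  ext l i
  exact key m l i (by omega)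

theorem isNilpotentOsserman {g : Metric m} (hg : IsGeneralizedPlaneWave g) :
    IsNilpotentOsserman g := fun x ξ =>
  pow_card_eq_zero_of_strictly_lower fun l i h => by
    simp [jacobiOp, curvature_eq_zero hg (Or.inl h)]

theorem isNilpotentIvanovPetrova {g : Metric m} (hg : IsGeneralizedPlaneWave g) :
    IsNilpotentIvanovPetrova g := fun x e₁ e₂ _ =>
  pow_card_eq_zero_of_strictly_lower fun l k h => by
    simp [curvatureOp, curvature_eq_zero hg (Or.inr (Or.inr h))]

theorem isNilpotentSzabo {g : Metric m} (hg : IsGeneralizedPlaneWave g) :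
    IsNilpotentSzabo g := fun x ξ =>
  pow_card_eq_zero_of_strictly_lower fun l i h => by
    simp only [szaboOp, Matrix.of_apply]
    refine Finset.sum_eq_zero fun j _ => Finset.sum_eq_zero fun k _ =>
      Finset.sum_eq_zero fun n _ => ?_
    rw [(isTriangular_nablaR hg 1 ![i, j, k, n] l).1 ⟨(0 : Fin 4), h⟩]
    simp

theorem isRicciFlat {g : Metric m} (hg : IsGeneralizedPlaneWave g) : IsRicciFlat g :=
  fun _ _ x => Finset.sum_eq_zero fun _ _ => curvature_eq_zero hg (Or.inl le_rfl) x

theorem isEinstein {g : Metric m} (hg : IsGeneralizedPlaneWave g) : IsEinstein g :=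
  ⟨0, fun i j x => by rw [isRicciFlat hg i j x, zero_mul]⟩

/-! ### Compatibility with the metric and skewness of the curvature -/

theorem sum_metric_mul_christoffel (g : Metric m) (i j k : Fin m) (x : E m) :
    ∑ r, g.toMatrix x k r * christoffel g i j r x =
      (1 / 2) * (pd i (fun y => g.toMatrix y j k) x + pd j (fun y => g.toMatrix y i k) x
        - pd k (fun y => g.toMatrix y i j) x) := by
  set v : Fin m → ℝ := fun l => pd i (fun y => g.toMatrix y j l) x
    + pd j (fun y => g.toMatrix y i l) x - pd l (fun y => g.toMatrix y i j) x
  have h1 : ∀ r, christoffel g i j r x = (1 / 2) * ((g.toMatrix x)⁻¹.mulVec v) r := fun r => rfl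
  have h2 : (g.toMatrix x).mulVec ((g.toMatrix x)⁻¹.mulVec v) = v := by
    rw [Matrix.mulVec_mulVec, Matrix.mul_nonsing_inv _ (g.nondeg x).isUnit, Matrix.one_mulVec]
  have h3 : (g.toMatrix x).mulVec ((g.toMatrix x)⁻¹.mulVec v) k = v k := by rw [h2]
  change _ = (1 / 2) * v k
  rw [← h3]
  simp only [h1]
  rw [Matrix.mulVec, dotProduct, Finset.mul_sum]
  exact Finset.sum_congr rfl fun r _ => by ring

/-- The Levi-Civita connection is metric. -/
theorem pd_metric (g : Metric m) (i j k : Fin m) (x : E m) :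
    pd i (fun y => g.toMatrix y j k) x =
      ∑ r, g.toMatrix x k r * christoffel g i j r x
        + ∑ r, g.toMatrix x j r * christoffel g i k r x := by
  have h : ∀ a b, (fun y => g.toMatrix y a b) = fun y => g.toMatrix y b a :=
    fun a b => funext fun y => (g.symm y).apply b a
  rw [sum_metric_mul_christoffel, sum_metric_mul_christoffel, h k j, h i j, h i k]
  ring

/-- Lowering the upper index commutes with covariant differentiation. -/
theorem sum_metric_mul_pd (g : Metric m) {u : Fin m → E m → ℝ} (hu : ∀ n, ContDiff ℝ ∞ (u n))
    (j l : Fin m) (x : E m) :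
    ∑ n, g.toMatrix x l n * (pd j (u n) x + ∑ r, christoffel g j r n x * u r x) =
      pd j (fun y => ∑ n, g.toMatrix y l n * u n y) x
        - ∑ r, christoffel g j l r x * ∑ n, g.toMatrix x r n * u n x := by
  rw [pd_sum _ fun n => (g.smooth l n).mul (hu n)]
  simp only [pd_mul (g.smooth _ _) (hu _), pd_metric g, mul_add, Finset.sum_add_distrib,
    Finset.mul_sum]
  have h1 : ∑ n, ∑ r, u n x * (g.toMatrix x n r * christoffel g j l r x) =
      ∑ r, ∑ n, christoffel g j l r x * (g.toMatrix x r n * u n x) := by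
    rw [Finset.sum_comm]
    refine Finset.sum_congr rfl fun r _ => Finset.sum_congr rfl fun n _ => ?_
    rw [(g.symm x).apply r n]; ring
  have h2 : ∑ n, ∑ r, u n x * (g.toMatrix x l r * christoffel g j n r x) =
      ∑ n, ∑ r, g.toMatrix x l n * (christoffel g j r n x * u r x) := by
    rw [Finset.sum_comm]
    refine Finset.sum_congr rfl fun r _ => Finset.sum_congr rfl fun n _ => ?_
    ring
  rw [h1, h2]
  ring

/-- The lowered components `R_{ijkl}`. -/
theorem sum_metric_mul_curvature (g : Metric m) (i j k l : Fin m) (x : E m) :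
    ∑ n, g.toMatrix x l n * curvature g i j k n x =
      pd i (fun y => ∑ n, g.toMatrix y l n * christoffel g j k n y) x
      - pd j (fun y => ∑ n, g.toMatrix y l n * christoffel g i k n y) x
      - (∑ r, christoffel g i l r x * ∑ n, g.toMatrix x r n * christoffel g j k n x)
      + ∑ r, christoffel g j l r x * ∑ n, g.toMatrix x r n * christoffel g i k n x := by
  have h1 := sum_metric_mul_pd g (u := fun n => christoffel g j k n)
    (fun n => contDiff_christoffel g _ _ _) i l x
  have h2 := sum_metric_mul_pd g (u := fun n => christoffel g i k n)
    (fun n => contDiff_christoffel g _ _ _) j l x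
  have h3 : ∀ n, g.toMatrix x l n * curvature g i j k n x =
      g.toMatrix x l n * (pd i (christoffel g j k n) x
        + ∑ r, christoffel g i r n x * christoffel g j k r x)
      - g.toMatrix x l n * (pd j (christoffel g i k n) x
        + ∑ r, christoffel g j r n x * christoffel g i k r x) := by
    intro n
    unfold curvature
    rw [Finset.sum_sub_distrib]
    ring
  simp only [h3, Finset.sum_sub_distrib]
  rw [h1, h2]
  ring

/-- By metric compatibility the derivative terms add up to the commutator of `∂_i` and `∂_j` on
`g_{kl}`, which is zero; the quadratic terms cancel by the symmetry of `g`. -/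
theorem curvature_skew (g : Metric m) (i j k l : Fin m) (x : E m) :
    ∑ n, g.toMatrix x l n * curvature g i j k n x
      + ∑ n, g.toMatrix x k n * curvature g i j l n x = 0 := by
  rw [sum_metric_mul_curvature, sum_metric_mul_curvature]
  have hΓ : ∀ a b c, ContDiff ℝ ∞ (fun y => ∑ n, g.toMatrix y c n * christoffel g a b n y) :=
    fun a b c => ContDiff.sum fun n _ => (g.smooth _ _).mul (contDiff_christoffel g _ _ _)
  have h1 : ∀ a b, pd a (fun y => ∑ n, g.toMatrix y l n * christoffel g b k n y) x
      + pd a (fun y => ∑ n, g.toMatrix y k n * christoffel g b l n y) x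
      = pd a (pd b fun y => g.toMatrix y k l) x := by
    intro a b
    rw [← pd_add (hΓ _ _ _) (hΓ _ _ _)]
    congr 1
    funext y
    rw [pd_metric]
  have h2 : ∀ a b c d, ∑ r, christoffel g a c r x * ∑ n, g.toMatrix x r n * christoffel g b d n x =
      ∑ r, christoffel g b d r x * ∑ n, g.toMatrix x r n * christoffel g a c n x := by
    intro a b c d
    simp only [Finset.mul_sum]
    rw [Finset.sum_comm]
    refine Finset.sum_congr rfl fun r _ => Finset.sum_congr rfl fun n _ => ?_
    rw [(g.symm x).apply r n]; ring
  have h3 := pd_comm (g.smooth k l) i j x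
  rw [h2 i j l k, h2 i j k l]
  linarith [h1 i j, h1 j i]

/-- Skewness, with respect to the metric, of a tensor in the lower index `c` and the upper one. -/
def IsSkewAt {n : ℕ} (g : Metric m) (c : Fin n) (T : (Fin n → Fin m) → Fin m → E m → ℝ) : Prop :=
  ∀ (I : Fin n → Fin m) (l : Fin m) (x : E m),
    ∑ r, g.toMatrix x l r * T I r x
      + ∑ r, g.toMatrix x (I c) r * T (Function.update I c l) r x = 0

theorem sum_metric_mul_covDeriv (g : Metric m) {n : ℕ} {T : (Fin n → Fin m) → Fin m → E m → ℝ}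
    (hs : ∀ I k, ContDiff ℝ ∞ (T I k)) (J : Fin (n + 1) → Fin m) (l : Fin m) (x : E m) :
    ∑ k, g.toMatrix x l k * covDeriv g T J k x =
      pd (J (Fin.last n)) (fun y => ∑ k, g.toMatrix y l k * T (fun a => J a.castSucc) k y) x
      - (∑ r, christoffel g (J (Fin.last n)) l r x *
          ∑ k, g.toMatrix x r k * T (fun a => J a.castSucc) k x)
      - ∑ a : Fin n, ∑ r, christoffel g (J (Fin.last n)) (J a.castSucc) r x *
          ∑ k, g.toMatrix x l k * T (Function.update (fun a => J a.castSucc) a r) k x := by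
  rw [← sum_metric_mul_pd g (fun k => hs _ k)]
  have h : ∑ a : Fin n, ∑ r, christoffel g (J (Fin.last n)) (J a.castSucc) r x *
          ∑ k, g.toMatrix x l k * T (Function.update (fun a => J a.castSucc) a r) k x =
      ∑ k, g.toMatrix x l k * ∑ a : Fin n, ∑ r, christoffel g (J (Fin.last n)) (J a.castSucc) r x *
          T (Function.update (fun a => J a.castSucc) a r) k x := by
    simp only [Finset.mul_sum]
    conv_rhs => rw [Finset.sum_comm]
    refine Finset.sum_congr rfl fun a _ => ?_
    rw [Finset.sum_comm]
    refine Finset.sum_congr rfl fun r _ => Finset.sum_congr rfl fun k _ => ?_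
    ring
  rw [h, ← Finset.sum_sub_distrib]
  refine Finset.sum_congr rfl fun k _ => ?_
  unfold covDeriv
  dsimp only
  ring

/-- After lowering the upper index, the derivative terms and the corrections in the slots other than
`c` cancel by the skewness of `T`. The correction in slot `c` of one summand cancels against the
correction for the lowered index of the other. -/
theorem IsSkewAt.covDeriv {g : Metric m} {n : ℕ} {c : Fin n}
    {T : (Fin n → Fin m) → Fin m → E m → ℝ} (hT : IsSkewAt g c T)
    (hs : ∀ I k, ContDiff ℝ ∞ (T I k)) : IsSkewAt g c.castSucc (covDeriv g T) := by
  intro J l x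
  set I : Fin n → Fin m := fun a => J a.castSucc with hI
  set j : Fin m := J (Fin.last n) with hj
  have hI' : (fun a : Fin n => Function.update J c.castSucc l a.castSucc) =
      Function.update I c l := by
    funext a
    by_cases h : a = c
    · subst h; simp
    · simp [hI, h]
  have hj' : Function.update J c.castSucc l (Fin.last n) = j := by
    rw [Function.update_of_ne (Fin.castSucc_lt_last c).ne']
  rw [sum_metric_mul_covDeriv g hs, sum_metric_mul_covDeriv g hs, hI', hj']
  have hS : ∀ I l, ContDiff ℝ ∞ (fun y => ∑ k, g.toMatrix y l k * T I k y) :=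
    fun I l => ContDiff.sum fun k _ => (g.smooth _ _).mul (hs _ _)
  have h1 : pd j (fun y => ∑ k, g.toMatrix y l k * T I k y) x
      + pd j (fun y => ∑ k, g.toMatrix y (I c) k * T (Function.update I c l) k y) x = 0 := by
    rw [← pd_add (hS _ _) (hS _ _)]
    have : (fun y => ∑ k, g.toMatrix y l k * T I k y
        + ∑ k, g.toMatrix y (I c) k * T (Function.update I c l) k y) = fun _ => 0 :=
      funext fun y => hT I l y
    rw [this, pd_const]
  have h2 : ∀ a : Fin n, Function.update J c.castSucc l a.castSucc = Function.update I c l a :=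
    fun a => congrFun hI' a
  simp only [h2]
  have h3 : ∀ a, a ≠ c → (∑ r, christoffel g j (I a) r x *
        ∑ k, g.toMatrix x l k * T (Function.update I a r) k x)
      + (∑ r, christoffel g j (Function.update I c l a) r x *
        ∑ k, g.toMatrix x (I c) k * T (Function.update (Function.update I c l) a r) k x) = 0 := by
    intro a ha
    rw [Function.update_of_ne ha, ← Finset.sum_add_distrib]
    refine Finset.sum_eq_zero fun r _ => ?_
    have := hT (Function.update I a r) l x
    rw [Function.update_of_ne ha.symm, Function.update_comm ha] at this
    rw [← mul_add, this, mul_zero]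
  have h4 : (∑ r, christoffel g j (I c) r x *
        ∑ k, g.toMatrix x l k * T (Function.update I c r) k x)
      + (∑ r, christoffel g j (I c) r x *
        ∑ k, g.toMatrix x r k * T (Function.update I c l) k x) = 0 := by
    rw [← Finset.sum_add_distrib]
    refine Finset.sum_eq_zero fun r _ => ?_
    have := hT (Function.update I c r) l x
    rw [Function.update_self, Function.update_idem] at this
    rw [← mul_add, this, mul_zero]
  have h5 : (∑ r, christoffel g j l r x *
        ∑ k, g.toMatrix x (I c) k * T (Function.update I c r) k x)
      + (∑ r, christoffel g j l r x * ∑ k, g.toMatrix x r k * T I k x) = 0 := by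
    rw [← Finset.sum_add_distrib]
    refine Finset.sum_eq_zero fun r _ => ?_
    have := hT I r x
    rw [← mul_add, add_comm, this, mul_zero]
  have h6 : (∑ a, ∑ r, christoffel g j (I a) r x *
        ∑ k, g.toMatrix x l k * T (Function.update I a r) k x)
      + (∑ a, ∑ r, christoffel g j (Function.update I c l a) r x *
        ∑ k, g.toMatrix x (I c) k * T (Function.update (Function.update I c l) a r) k x)
      = (∑ r, christoffel g j (I c) r x *
        ∑ k, g.toMatrix x l k * T (Function.update I c r) k x)
      + (∑ r, christoffel g j l r x *
        ∑ k, g.toMatrix x (I c) k * T (Function.update I c r) k x) := by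
    rw [← Finset.sum_add_distrib, Finset.sum_eq_single c (fun a _ ha => h3 a ha) (by simp)]
    simp only [Function.update_self, Function.update_idem]
  change _ - _ - (∑ a, ∑ r, christoffel g j (I a) r x *
        ∑ k, g.toMatrix x l k * T (Function.update I a r) k x)
    + (pd j (fun y => ∑ k, g.toMatrix y (I c) k * T (Function.update I c l) k y) x -
      (∑ r, christoffel g j (I c) r x *
        ∑ k, g.toMatrix x r k * T (Function.update I c l) k x) - _) = 0
  linarith

theorem isSkewAt_nablaR (g : Metric m) (ν : ℕ) :
    IsSkewAt g (Fin.castAdd ν (2 : Fin 3)) (nablaR g ν) := by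
  induction ν with
  | zero =>
    intro I l x
    have h := curvature_skew g (I (0 : Fin 3)) (I (1 : Fin 3)) (I (2 : Fin 3)) l x
    exact h
  | succ ν ih => exact ih.covDeriv (contDiff_nablaR g ν)

/-! ### A basis adapted to the coordinate flag in which the metric is monomial -/

/-- Upper triangular with all diagonal entries `1`. -/
def IsUnitri (A : Matrix (Fin m) (Fin m) ℝ) : Prop :=
  (∀ i j, j < i → A i j = 0) ∧ ∀ i, A i i = 1

theorem IsUnitri.det {A : Matrix (Fin m) (Fin m) ℝ} (hA : IsUnitri A) : A.det = 1 := by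
  rw [Matrix.det_of_isUpperTriangular (fun i j h => hA.1 i j h)]
  simp [hA.2]

theorem isUnitri_one : IsUnitri (1 : Matrix (Fin m) (Fin m) ℝ) :=
  ⟨fun _ _ h => Matrix.one_apply_ne h.ne', fun i => Matrix.one_apply_eq i⟩

/-- The rows in `S` have at most one nonzero entry, in a column of `S`. -/
def IsMonomialOn (S : Finset (Fin m)) (H : Matrix (Fin m) (Fin m) ℝ) : Prop :=
  ∀ i ∈ S, ∃ j ∈ S, ∀ k, k ≠ j → H i k = 0

/-- The elementary move `e_i ↦ e_i - c i • e_q`. It is unitriangular because only vectors before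
`e_q` are altered. -/
theorem exists_isUnitri_conj_apply (H : Matrix (Fin m) (Fin m) ℝ) (q : Fin m) (c : Fin m → ℝ)
    (hc : ∀ i, q ≤ i → c i = 0) :
    ∃ A : Matrix (Fin m) (Fin m) ℝ, IsUnitri A ∧ ∀ i k, (A * H * A.transpose) i k =
      H i k - c i * H q k - c k * (H i q - c i * H q q) := by
  let A : Matrix (Fin m) (Fin m) ℝ := 1 - Matrix.vecMulVec c (Pi.single q 1)
  have hA : ∀ (X : Matrix (Fin m) (Fin m) ℝ) i k, (A * X) i k = X i k - c i * X q k := by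
    intro X i k
    rw [show A = 1 - Matrix.vecMulVec c (Pi.single q 1) from rfl, sub_mul, one_mul,
      Matrix.sub_apply, Matrix.mul_apply]
    simp [Matrix.vecMulVec_apply, Pi.single_apply]
  refine ⟨A, ⟨fun i j h => ?_, fun i => ?_⟩, fun i k => ?_⟩
  · by_cases hj : j = q
    · subst hj
      simp [A, Matrix.vecMulVec_apply, Matrix.one_apply_ne h.ne', hc i h.le]
    · simp [A, Matrix.vecMulVec_apply, Matrix.one_apply_ne h.ne', hj]
  · by_cases hj : i = q
    · subst hj
      simp [A, Matrix.vecMulVec_apply, hc i le_rfl]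
    · simp [A, Matrix.vecMulVec_apply, hj]
  · have h1 : (A * H * A.transpose) i k = (A * (A * H).transpose) k i := by
      rw [← Matrix.transpose_apply (A * (A * H).transpose), Matrix.transpose_mul,
        Matrix.transpose_transpose]
    rw [h1, hA, Matrix.transpose_apply, Matrix.transpose_apply, hA, hA]

/-- One step of a Gram–Schmidt process from the last vector of the flag backwards. The last unused
vector `e_p` either splits off alone or together with the last `e_j` that pairs with it
nontrivially. Taking both indices maximal is what makes the clearing moves unitriangular. -/
theorem IsMonomialOn.exists_extend {S : Finset (Fin m)} {H : Matrix (Fin m) (Fin m) ℝ}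
    (hS : IsMonomialOn S H) (hsymm : H.IsSymm) (hdet : H.det ≠ 0) (hne : S ≠ Finset.univ) :
    ∃ A S', IsUnitri A ∧ S ⊂ S' ∧ IsMonomialOn S' (A * H * A.transpose) := by
  have hsc : Sᶜ.Nonempty := by
    rw [Finset.nonempty_iff_ne_empty, Ne, Finset.compl_eq_empty_iff]; exact hne
  obtain ⟨p, hpS, hpmax⟩ := Sᶜ.exists_max_image id hsc
  rw [Finset.mem_compl] at hpS
  have hp : ∀ i, p < i → i ∈ S := fun i hi => by
    by_contra h
    exact absurd (hpmax i (Finset.mem_compl.2 h)) (not_le.2 hi)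
  have hrow : (Finset.univ.filter fun l => H p l ≠ 0).Nonempty := by
    by_contra h
    rw [Finset.not_nonempty_iff_eq_empty, Finset.filter_eq_empty_iff] at h
    exact hdet (Matrix.det_eq_zero_of_row_eq_zero p fun j => by simpa using h (Finset.mem_univ j))
  obtain ⟨j, hj, hjmax⟩ := (Finset.univ.filter fun l => H p l ≠ 0).exists_max_image id hrow
  have hj : H p j ≠ 0 := by simpa using hj
  have hjmax : ∀ l, j < l → H p l = 0 := fun l hl => by
    by_contra h
    exact absurd (hjmax l (by simpa using h)) (not_le.2 hl)
  have hsy : ∀ a b, H a b = H b a := fun a b => hsymm.apply b a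
  have hout : ∀ i ∈ S, ∀ k, k ∉ S → H i k = 0 := fun i hi k hk => by
    obtain ⟨l, hl, h⟩ := hS i hi
    exact h k (by rintro rfl; exact hk hl)
  have hjS : j ∉ S := fun h => hj (by rw [hsy]; exact hout j h p hpS)
  have hjp : j ≤ p := not_lt.1 fun h => hjS (hp j h)
  rcases hjp.eq_or_lt with rfl | hjp
  -- Here `H p p ≠ 0`, so subtracting multiples of `e_p` makes all other vectors orthogonal to it.
  · obtain ⟨A, hA, hH⟩ := exists_isUnitri_conj_apply H j
      (fun i => if i = j then 0 else H i j / H j j) (fun i hi => by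
        rcases hi.eq_or_lt with rfl | hi
        · simp
        · simp [hi.ne', hout i (hp i hi) j hpS])
    refine ⟨A, insert j S, hA, Finset.ssubset_insert hpS, ?_⟩
    intro i hi
    rcases Finset.mem_insert.1 hi with rfl | hi
    · refine ⟨i, Finset.mem_insert_self _ _, fun k hk => ?_⟩
      rw [hH]
      simp only [hk, if_true, if_false]
      rw [hsy k i]
      field_simp
      ring
    · obtain ⟨l, hl, h⟩ := hS i hi
      refine ⟨l, Finset.mem_insert_of_mem hl, fun k hk => ?_⟩
      rw [hH, h k hk, hout i hi j hpS]
      simp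
  · have hpp : H p p = 0 := hjmax p hjp
    -- Here `e_p` is isotropic. Multiples of `e_j` first clear row `p` outside column `j`.
    obtain ⟨A, hA, hH⟩ := exists_isUnitri_conj_apply H j
      (fun i => if i = j then 0 else H p i / H p j) (fun i hi => by
        rcases hi.eq_or_lt with rfl | hi
        · simp
        · simp [hjmax i hi])
    set H₁ := A * H * A.transpose with hH₁
    have hsy₁ : ∀ a b, H₁ a b = H₁ b a := by
      have : H₁.IsSymm := by
        unfold Matrix.IsSymm
        rw [hH₁, Matrix.transpose_mul, Matrix.transpose_mul, Matrix.transpose_transpose, hsymm.eq,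
          Matrix.mul_assoc]
      exact fun a b => this.apply b a
    have h1S : ∀ i ∈ S, ∀ k, H₁ i k = H i k := by
      intro i hi k
      have hij : i ≠ j := by rintro rfl; exact hjS hi
      rw [hH, hout i hi j hjS, hsy p i, hout i hi p hpS]
      simp [hij]
    have h1p : ∀ k, k ≠ j → H₁ p k = 0 := by
      intro k hk
      rw [hH]
      simp only [hk, hjp.ne', if_false, hpp]
      field_simp
      ring
    have h1pj : H₁ p j ≠ 0 := by
      rw [hH]
      simp [hpp, hj]
    -- Multiples of `e_p` then clear row `j` outside column `p`. The diagonal entry at `j` changes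
    -- by twice the coefficient times `H₁ p j`, hence the factor `2`.
    obtain ⟨B, hB, hH2⟩ := exists_isUnitri_conj_apply H₁ p
      (fun i => if i = p then 0 else if i = j then H₁ j j / (2 * H₁ p j) else H₁ i j / H₁ p j)
      (fun i hi => by
        rcases hi.eq_or_lt with rfl | hi
        · simp
        · have hij : i ≠ j := (hjp.trans hi).ne'
          simp [hi.ne', hij, h1S i (hp i hi), hout i (hp i hi) j hjS])
    refine ⟨B * A, insert j (insert p S), unitri_mul hB hA, ?_, ?_⟩
    · exact (Finset.ssubset_insert hpS).trans_subset (Finset.subset_insert _ _)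
    have : B * A * H * (B * A).transpose = B * H₁ * B.transpose := by
      rw [hH₁, Matrix.transpose_mul]
      simp only [Matrix.mul_assoc]
    rw [this]
    have h1pp : H₁ p p = 0 := h1p p hjp.ne'
    intro i hi
    rcases Finset.mem_insert.1 hi with rfl | hi
    · refine ⟨p, by simp, fun k hk => ?_⟩
      rw [hH2]
      by_cases hki : k = i
      · subst hki
        simp only [hjp.ne, if_true, if_false, h1pp, hsy₁ k p]
        field_simp
        ring
      · simp only [hk, hki, hjp.ne, if_true, if_false, h1pp, h1p k hki, hsy₁ i p, hsy₁ k i]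
        field_simp
        ring
    rcases Finset.mem_insert.1 hi with rfl | hi
    · refine ⟨j, by simp, fun k hk => ?_⟩
      rw [hH2]
      simp [h1p k hk, h1pp]
    · obtain ⟨l, hl, h⟩ := hS i hi
      refine ⟨l, by simp [hl], fun k hk => ?_⟩
      have hij : i ≠ j := fun h => hjS (h ▸ hi)
      have hip : i ≠ p := fun h => hpS (h ▸ hi)
      rw [hH2]
      simp [hij, hip, h1S i hi, h k hk, hout i hi p hpS, hout i hi j hjS]

/-- A nondegenerate symmetric form is monomial in some basis adapted to a given full flag. -/
theorem exists_isUnitri_isMonomialOn {H : Matrix (Fin m) (Fin m) ℝ} (hsymm : H.IsSymm)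
    (hdet : H.det ≠ 0) :
    ∃ A, IsUnitri A ∧ IsMonomialOn Finset.univ (A * H * A.transpose) := by
  suffices key : ∀ (n : ℕ) (S : Finset (Fin m)) (H : Matrix (Fin m) (Fin m) ℝ), Sᶜ.card ≤ n →
      IsMonomialOn S H → H.IsSymm → H.det ≠ 0 →
      ∃ A, IsUnitri A ∧ IsMonomialOn Finset.univ (A * H * A.transpose) from
    key _ ∅ H le_rfl (fun i hi => absurd hi (Finset.notMem_empty i)) hsymm hdet
  intro n
  induction n with
  | zero =>
    intro S H hn hS _ _
    have : S = Finset.univ := by simpa using hn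
    subst this
    exact ⟨1, isUnitri_one, by simpa using hS⟩
  | succ n ih =>
    intro S H hn hS hsymm hdet
    by_cases hne : S = Finset.univ
    · subst hne
      exact ⟨1, isUnitri_one, by simpa using hS⟩
    obtain ⟨A, S', hA, hSS, hS'⟩ := hS.exists_extend hsymm hdet hne
    obtain ⟨B, hB, h⟩ := ih S' (A * H * A.transpose)
      (by
        have := Finset.card_lt_card (Finset.compl_ssubset_compl.2 hSS)
        omega) hS'
      (by
        unfold Matrix.IsSymm
        rw [Matrix.transpose_mul, Matrix.transpose_mul, Matrix.transpose_transpose, hsymm.eq,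
          Matrix.mul_assoc])
      (by rw [Matrix.det_mul, Matrix.det_mul, Matrix.det_transpose, hA.det]; simpa using hdet)
    refine ⟨B * A, unitri_mul hB hA, ?_⟩
    have : B * A * H * (B * A).transpose = B * (A * H * A.transpose) * B.transpose := by
      rw [Matrix.transpose_mul]
      simp only [Matrix.mul_assoc]
    rw [this]
    exact h

/-! ### Change of basis in tensors and in complete contractions -/

/-- The components of a tensor with `n` lower indices and one upper index in the basis
`e_i = ∑ j, A i j • ∂_j`, where `B = A⁻¹`. -/
def changeBasis {n : ℕ} (A B : Matrix (Fin m) (Fin m) ℝ) (T : (Fin n → Fin m) → Fin m → ℝ) :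
    (Fin n → Fin m) → Fin m → ℝ := fun I k =>
  ∑ p : (Fin n → Fin m) × Fin m, (∏ a, A (I a) (p.1 a)) * B p.2 k * T p.1 p.2

/-- A nonzero summand gives the chain `I a ≤ p.1 a < p.2 ≤ k`, from `A`, `T` and `B` respectively.
-/
theorem changeBasis_ne_zero {n : ℕ} {A B : Matrix (Fin m) (Fin m) ℝ} (hA : IsUnitri A)
    (hB : IsUnitri B) {T : (Fin n → Fin m) → Fin m → ℝ}
    (hT : ∀ I k a, k ≤ I a → T I k = 0) {I : Fin n → Fin m} {k : Fin m}
    (h : changeBasis A B T I k ≠ 0) (a : Fin n) : I a < k := by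
  by_contra hk
  rw [not_lt] at hk
  refine h (Finset.sum_eq_zero fun p _ => ?_)
  by_cases h1 : p.1 a < I a
  · rw [Finset.prod_eq_zero (Finset.mem_univ a) (hA.1 _ _ h1)]
    simp
  by_cases h2 : k < p.2
  · rw [hB.1 _ _ h2]
    simp
  rw [hT p.1 p.2 a ((not_lt.1 h2).trans (hk.trans (not_lt.1 h1))), mul_zero]

theorem changeBasis_skew {n : ℕ} {A B G : Matrix (Fin m) (Fin m) ℝ} (hBA : B * A = 1)
    {T : (Fin n → Fin m) → Fin m → ℝ} {c : Fin n}
    (hT : ∀ I l, ∑ r, G l r * T I r + ∑ r, G (I c) r * T (Function.update I c l) r = 0)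
    (I : Fin n → Fin m) (l : Fin m) :
    ∑ r, (A * G * A.transpose) l r * changeBasis A B T I r
      + ∑ r, (A * G * A.transpose) (I c) r * changeBasis A B T (Function.update I c l) r = 0 := by
  -- Once lowered, the upper index transforms by `A` like all the others, because `B` cancels one
  -- factor `A` of the new metric.
  have key : ∀ I l, ∑ r, (A * G * A.transpose) l r * changeBasis A B T I r =
      ∑ p : (Fin n → Fin m) × Fin m, (∏ a, A (I a) (p.1 a)) * A l p.2 *
        ∑ r, G p.2 r * T p.1 r := by
    intro I l
    have h1 : ∀ q, ∑ r, (A * G * A.transpose) l r * B q r = ∑ s, A l s * G s q := by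
      intro q
      have : A * G * A.transpose * B.transpose = A * G := by
        rw [Matrix.mul_assoc, ← Matrix.transpose_mul, hBA, Matrix.transpose_one, Matrix.mul_one]
      have := congrFun (congrFun this l) q
      rw [Matrix.mul_apply] at this
      simp only [Matrix.transpose_apply] at this
      rw [this, Matrix.mul_apply]
    simp only [changeBasis, Finset.mul_sum]
    rw [Finset.sum_comm]
    rw [Fintype.sum_prod_type, Fintype.sum_prod_type]
    refine Finset.sum_congr rfl fun J _ => ?_
    have h2 : ∀ q, ∑ r, (A * G * A.transpose) l r * ((∏ a, A (I a) (J a)) * B q r * T J q) =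
        ∑ s, (∏ a, A (I a) (J a)) * A l s * (G s q * T J q) := by
      intro q
      have : ∑ r, (A * G * A.transpose) l r * ((∏ a, A (I a) (J a)) * B q r * T J q) =
          (∑ r, (A * G * A.transpose) l r * B q r) * ((∏ a, A (I a) (J a)) * T J q) := by
        rw [Finset.sum_mul]
        exact Finset.sum_congr rfl fun r _ => by ring
      rw [this, h1, Finset.sum_mul]
      exact Finset.sum_congr rfl fun r _ => by ring
    simp only [h2]
    rw [Finset.sum_comm]
  rw [key, key]
  -- Interchanging the summation index of slot `c` with the lowered one matches the two sums term by
  -- term.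
  let φ : (Fin n → Fin m) × Fin m → (Fin n → Fin m) × Fin m :=
    fun p => (Function.update p.1 c p.2, p.1 c)
  have hφ : Function.Involutive φ := by
    rintro ⟨J, q⟩
    simp [φ]
  rw [← Equiv.sum_comp hφ.toPerm, ← Finset.sum_add_distrib]
  refine Finset.sum_eq_zero fun p _ => ?_
  have h1 : (∏ a, A (Function.update I c l a) (p.1 a)) * A (I c) p.2 =
      (∏ a, A (I a) (Function.update p.1 c p.2 a)) * A l (p.1 c) := by
    rw [← Finset.mul_prod_erase _ _ (Finset.mem_univ c),
      ← Finset.mul_prod_erase _ (fun a => A (I a) (Function.update p.1 c p.2 a))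
        (Finset.mem_univ c)]
    have : ∏ a ∈ Finset.univ.erase c, A (Function.update I c l a) (p.1 a) =
        ∏ a ∈ Finset.univ.erase c, A (I a) (Function.update p.1 c p.2 a) := by
      refine Finset.prod_congr rfl fun a ha => ?_
      have : a ≠ c := (Finset.mem_erase.1 ha).1
      rw [Function.update_of_ne this, Function.update_of_ne this]
    rw [this]
    simp only [Function.update_self]
    ring
  have h2 := hT p.1 p.2
  change (∏ a, A (I a) (Function.update p.1 c p.2 a)) * A l (p.1 c) *
    (∑ r, G (p.1 c) r * T (Function.update p.1 c p.2) r) + _ = 0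
  rw [h1, ← mul_add, add_comm, h2, mul_zero]

/-- A complete contraction of tensors `T s` with matrices `Gi` (upper indices) and `G` (lower
indices), along the pairing of a monomial. -/
noncomputable def WeylMonomial.contract (Θ : WeylMonomial)
    (T : ∀ s, (Fin (3 + Θ.order s) → Fin m) → Fin m → ℝ) (Gi G : Matrix (Fin m) (Fin m) ℝ) : ℝ :=
  ∑ f : Fin Θ.numR ⊕ (Fin Θ.numInv × Fin 2) → Fin m,
    (∏ s : Fin Θ.numR, T s (fun a => f (Θ.pairing (Sum.inl ⟨s, a⟩))) (f (Sum.inl s))) *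
    (∏ b : Fin Θ.numInv, Gi (f (Sum.inr (b, 0))) (f (Sum.inr (b, 1)))) *
    (∏ c : Fin Θ.numMet, G (f (Θ.pairing (Sum.inr (c, 0)))) (f (Θ.pairing (Sum.inr (c, 1)))))

theorem conj_apply_eq_sum (A G : Matrix (Fin m) (Fin m) ℝ) (i j : Fin m) :
    (A * G * A.transpose) i j = ∑ q : Fin 2 → Fin m, A i (q 0) * A j (q 1) * G (q 0) (q 1) := by
  rw [← (finTwoArrowEquiv (Fin m)).symm.sum_comp, Fintype.sum_prod_type, Matrix.mul_apply]
  rw [Finset.sum_comm]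
  refine Finset.sum_congr rfl fun k _ => ?_
  rw [Matrix.mul_apply, Finset.sum_mul]
  refine Finset.sum_congr rfl fun r _ => ?_
  simp [finTwoArrowEquiv]
  ring

theorem prod_sum_eq_sum_prod {ι : Type*} [Fintype ι] [DecidableEq ι] {κ : ι → Type*}
    [∀ i, Fintype (κ i)] (f : ∀ i, κ i → ℝ) : ∏ i, ∑ j, f i j = ∑ p : ∀ i, κ i, ∏ i, f i (p i) := by
  rw [Finset.prod_univ_sum, Fintype.piFinset_univ]

/-- The sum over `f` factors over the pairs of slots, and each pair contributes an entry of `B * A =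
1`. -/
theorem sum_prod_mul_prod_eq_ite {L U : Type*} [Fintype L] [Fintype U] [DecidableEq U]
    (π : L ≃ U) {A B : Matrix (Fin m) (Fin m) ℝ} (hBA : B * A = 1) (lam : L → Fin m)
    (mu : U → Fin m) :
    ∑ f : U → Fin m, (∏ d, A (f (π d)) (lam d)) * (∏ u, B (mu u) (f u)) =
      if ∀ d, mu (π d) = lam d then 1 else 0 := by
  have h1 : ∀ f : U → Fin m, (∏ d, A (f (π d)) (lam d)) * (∏ u, B (mu u) (f u)) =
      ∏ u, B (mu u) (f u) * A (f u) (lam (π.symm u)) := by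
    intro f
    rw [Finset.prod_mul_distrib, mul_comm,
      ← Equiv.prod_comp π (fun u => A (f u) (lam (π.symm u)))]
    simp
  simp only [h1]
  rw [← prod_sum_eq_sum_prod (fun u i => B (mu u) i * A i (lam (π.symm u)))]
  have h2 : ∀ u, ∑ i, B (mu u) i * A i (lam (π.symm u)) =
      if mu u = lam (π.symm u) then 1 else 0 := by
    intro u
    rw [← Matrix.mul_apply, hBA, Matrix.one_apply]
  simp only [h2]
  rw [Finset.prod_ite_zero]
  have : (∀ u ∈ Finset.univ, mu u = lam (π.symm u)) ↔ ∀ d, mu (π d) = lam d := by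
    constructor
    · intro h d
      simpa using h (π d) (Finset.mem_univ _)
    · intro h u _
      simpa using h (π.symm u)
  simp only [this, Finset.prod_const_one]

/-- Complete contractions do not depend on the basis. -/
theorem WeylMonomial.contract_changeBasis (Θ : WeylMonomial)
    (T : ∀ s, (Fin (3 + Θ.order s) → Fin m) → Fin m → ℝ) (Gi G : Matrix (Fin m) (Fin m) ℝ)
    {A B : Matrix (Fin m) (Fin m) ℝ} (hBA : B * A = 1) :
    Θ.contract (fun s => changeBasis A B (T s)) (B.transpose * Gi * B) (A * G * A.transpose) =
      Θ.contract T Gi G := by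
  -- `X` collects independent old-basis indices for all slots; `lam` and `mu` read off those in the
  -- lower and in the upper slots.
  let X := (∀ s : Fin Θ.numR, (Fin (3 + Θ.order s) → Fin m) × Fin m) ×
    (Fin Θ.numInv → Fin 2 → Fin m) × (Fin Θ.numMet → Fin 2 → Fin m)
  let lam : X → ((s : Fin Θ.numR) × Fin (3 + Θ.order s)) ⊕ (Fin Θ.numMet × Fin 2) → Fin m :=
    fun p => Sum.elim (fun d => (p.1 d.1).1 d.2) (fun d => p.2.2 d.1 d.2)
  let mu : X → Fin Θ.numR ⊕ (Fin Θ.numInv × Fin 2) → Fin m :=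
    fun p => Sum.elim (fun s => (p.1 s).2) (fun d => p.2.1 d.1 d.2)
  let F : X → ℝ := fun p => (∏ s, T s (p.1 s).1 (p.1 s).2) *
    (∏ b, Gi (p.2.1 b 0) (p.2.1 b 1)) * (∏ c, G (p.2.2 c 0) (p.2.2 c 1))
  have hGi : ∀ i j, (B.transpose * Gi * B) i j =
      ∑ q : Fin 2 → Fin m, B (q 0) i * B (q 1) j * Gi (q 0) (q 1) := by
    intro i j
    have := conj_apply_eq_sum B.transpose Gi i j
    simpa using this
  have hexp : Θ.contract (fun s => changeBasis A B (T s)) (B.transpose * Gi * B)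
      (A * G * A.transpose) = ∑ f : Fin Θ.numR ⊕ (Fin Θ.numInv × Fin 2) → Fin m, ∑ p : X,
        ((∏ d, A (f (Θ.pairing d)) (lam p d)) * (∏ u, B (mu p u) (f u))) * F p := by
    unfold contract
    refine Finset.sum_congr rfl fun f _ => ?_
    simp only [hGi, conj_apply_eq_sum A G, changeBasis]
    rw [prod_sum_eq_sum_prod, prod_sum_eq_sum_prod, prod_sum_eq_sum_prod, Fintype.sum_prod_type,
      mul_assoc, Finset.sum_mul_sum, Finset.sum_mul_sum]
    refine Finset.sum_congr rfl fun p _ => ?_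
    rw [Fintype.sum_prod_type]
    refine Finset.sum_congr rfl fun q _ => ?_
    rw [Finset.mul_sum]
    refine Finset.sum_congr rfl fun r _ => ?_
    simp only [F, lam, mu, Fintype.prod_sum_type, Fintype.prod_sigma, Fintype.prod_prod_type,
      Sum.elim_inl, Sum.elim_inr, Fin.prod_univ_two, Finset.prod_mul_distrib]
    ring
  rw [hexp, Finset.sum_comm]
  simp only [← Finset.sum_mul]
  simp only [sum_prod_mul_prod_eq_ite Θ.pairing hBA, ite_mul, one_mul, zero_mul]
  rw [← Finset.sum_filter]
  -- Only the `p` whose paired slots carry equal indices survive, and these are determined by their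
  -- upper indices.
  refine Finset.sum_nbij' (fun p => mu p)
    (fun f => (fun s => (fun a => f (Θ.pairing (Sum.inl ⟨s, a⟩)), f (Sum.inl s)),
      fun b e => f (Sum.inr (b, e)), fun c e => f (Θ.pairing (Sum.inr (c, e))))) ?_ ?_ ?_ ?_ ?_
  · simp
  · intro f _
    simp only [Finset.mem_filter, Finset.mem_univ, true_and]
    have hmu : mu (fun s => (fun a => f (Θ.pairing (Sum.inl ⟨s, a⟩)), f (Sum.inl s)),
        fun b e => f (Sum.inr (b, e)), fun c e => f (Θ.pairing (Sum.inr (c, e)))) = f := by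
      funext u
      rcases u with u | u <;> rfl
    rw [hmu]
    rintro (d | d) <;> rfl
  · intro p hp
    have hp := (Finset.mem_filter.1 hp).2
    refine Prod.ext (funext fun s => Prod.ext (funext fun a => ?_) rfl)
      (Prod.ext rfl (funext fun c => funext fun e => ?_))
    · exact hp (Sum.inl ⟨s, a⟩)
    · exact hp (Sum.inr (c, e))
  · intro f _
    funext u
    rcases u with u | u <;> rfl
  · intro p hp
    have hp := (Finset.mem_filter.1 hp).2
    have h1 : ∀ s a, mu p (Θ.pairing (Sum.inl ⟨s, a⟩)) = (p.1 s).1 a :=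
      fun s a => hp (Sum.inl ⟨s, a⟩)
    have h2 : ∀ c e, mu p (Θ.pairing (Sum.inr (c, e))) = p.2.2 c e :=
      fun c e => hp (Sum.inr (c, e))
    simp only [h1, h2]
    rfl

/-! ### Vanishing of the scalar Weyl invariants -/

/-- Exchanging the two slots of each metric factor is a bijection that turns the value `v` into `σ
v`. -/
theorem card_filter_comp_swap {α : Type*} [Fintype α] {h : α × Fin 2 → Fin m} {σ : Fin m → Fin m}
    (hσ : ∀ i, σ (σ i) = i) (h01 : ∀ b, h (b, 1) = σ (h (b, 0))) (v : Fin m) :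
    (Finset.univ.filter fun d => h d = v).card = (Finset.univ.filter fun d => h d = σ v).card := by
  have key : ∀ d : α × Fin 2, h (d.1, d.2.rev) = σ (h d) := by
    rintro ⟨b, e⟩
    fin_cases e
    · exact h01 b
    · change h (b, 0) = σ (h (b, 1))
      rw [h01, hσ]
  refine Finset.card_nbij' (fun d => (d.1, d.2.rev)) (fun d => (d.1, d.2.rev)) ?_ ?_ ?_ ?_
  · intro d hd
    simp only [Finset.coe_filter, Finset.mem_univ, true_and, Set.mem_ofPred_eq] at hd ⊢
    rw [key, hd]
  · intro d hd
    simp only [Finset.coe_filter, Finset.mem_univ, true_and, Set.mem_ofPred_eq] at hd ⊢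
    rw [key, hd, hσ]
  · intro d _
    simp
  · intro d _
    simp

theorem card_filter_sum {α β : Type*} [Fintype α] [Fintype β] (h : α ⊕ β → Fin m) (v : Fin m) :
    (Finset.univ.filter fun d => h d = v).card =
      (Finset.univ.filter fun d => h (Sum.inl d) = v).card
        + (Finset.univ.filter fun d => h (Sum.inr d) = v).card := by
  simp only [Finset.card_filter, Fintype.sum_sum_type]

/-- A complete contraction vanishes if, in some basis, the matrices `Gi` and `G` are supported on
the graph of an involution `σ`, and for each nonzero component of a tensor factor the upper index
exceeds all the lower ones and remains so when interchanged, through `σ`, with the lower index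
`c s`. -/
theorem WeylMonomial.contract_eq_zero (Θ : WeylMonomial)
    {T : ∀ s, (Fin (3 + Θ.order s) → Fin m) → Fin m → ℝ} {Gi G : Matrix (Fin m) (Fin m) ℝ}
    {σ : Fin m → Fin m} (hσ : ∀ i, σ (σ i) = i) (hGi : ∀ i j, Gi i j ≠ 0 → j = σ i)
    (hG : ∀ i j, G i j ≠ 0 → j = σ i) (c : ∀ s, Fin (3 + Θ.order s))
    (hT : ∀ s I k, T s I k ≠ 0 → ∀ a, I a < k)
    (hT' : ∀ s I k, T s I k ≠ 0 → σ k < σ (I (c s))) : Θ.contract T Gi G = 0 := by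
  refine Finset.sum_eq_zero fun f _ => ?_
  by_contra hne
  have hne' := mul_ne_zero_iff.1 hne
  have h3 := Finset.prod_ne_zero_iff.1 hne'.2
  have h2 := Finset.prod_ne_zero_iff.1 (mul_ne_zero_iff.1 hne'.1).2
  have h1 := Finset.prod_ne_zero_iff.1 (mul_ne_zero_iff.1 hne'.1).1
  let lR : Fin m → ℕ := fun v => (Finset.univ.filter
    fun d : (s : Fin Θ.numR) × Fin (3 + Θ.order s) => f (Θ.pairing (Sum.inl d)) = v).card
  let uR : Fin m → ℕ := fun v => (Finset.univ.filter
    fun s : Fin Θ.numR => f (Sum.inl s) = v).card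
  -- The pairing equates the counts of `v` over all lower and all upper slots. The metric slots
  -- contribute equally to `v` and `σ v`, so they drop out of the difference.
  have hbal : ∀ v, lR v + uR (σ v) = lR (σ v) + uR v := by
    have htot : ∀ v, (Finset.univ.filter fun d => f (Θ.pairing d) = v).card =
        (Finset.univ.filter fun u => f u = v).card := fun v =>
      Finset.card_equiv Θ.pairing (by simp)
    intro v
    have e1 := htot v
    have e2 := htot (σ v)
    rw [card_filter_sum, card_filter_sum (fun u => f u)] at e1 e2
    have e3 := card_filter_comp_swap (h := fun d => f (Sum.inr d)) hσ
      (fun b => hGi _ _ (h2 b (Finset.mem_univ b))) v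
    have e4 := card_filter_comp_swap (h := fun d => f (Θ.pairing (Sum.inr d))) hσ
      (fun b => hG _ _ (h3 b (Finset.mem_univ b))) v
    simp only [lR, uR]
    omega
  have hlR : ∀ s a, 0 < lR (f (Θ.pairing (Sum.inl ⟨s, a⟩))) := fun s a =>
    Finset.card_pos.2 ⟨⟨s, a⟩, by simp⟩
  have huR : ∀ s, 0 < uR (f (Sum.inl s)) := fun s => Finset.card_pos.2 ⟨s, by simp⟩
  let V := Finset.univ.filter fun v => 0 < lR v + uR (σ v)
  have hV : ∀ v, v ∈ V ↔ 0 < lR v + uR (σ v) := fun v => by simp [V]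
  have hVσ : ∀ v, v ∈ V → σ v ∈ V := fun v hv => by
    rw [hV] at hv ⊢
    have := hbal v
    rw [hσ]
    omega
  have hVup : ∀ s, f (Sum.inl s) ∈ V := fun s => by
    rw [← hσ (f (Sum.inl s))]
    refine hVσ _ ((hV _).2 ?_)
    rw [hσ]
    have := huR s
    omega
  -- If `M` is a lower index of a factor, its upper index is larger and lies in `V`. Otherwise `σ M`
  -- is an upper index, and `hT'` gives a larger element `σ (I (c s))` of `V`.
  obtain ⟨M, hM, hmax⟩ := V.exists_max_image id ⟨_, hVup ⟨0, Θ.numR_pos⟩⟩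
  have hM' := (hV M).1 hM
  rcases Nat.eq_zero_or_pos (lR M) with h0 | h0
  · have hu : 0 < uR (σ M) := by omega
    obtain ⟨s, hs⟩ := Finset.card_pos.1 hu
    have hs : f (Sum.inl s) = σ M := by simpa using hs
    have hlt := hT' s _ _ (h1 s (Finset.mem_univ s))
    rw [hs, hσ] at hlt
    refine absurd (hmax _ (hVσ (f (Θ.pairing (Sum.inl ⟨s, c s⟩))) ((hV _).2 ?_))) (not_le.2 hlt)
    have := hlR s (c s)
    omega
  · obtain ⟨⟨s, a⟩, hs⟩ := Finset.card_pos.1 h0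
    have hs : f (Θ.pairing (Sum.inl ⟨s, a⟩)) = M := by simpa using hs
    have hlt := hT s _ _ (h1 s (Finset.mem_univ s)) a
    rw [hs] at hlt
    exact absurd (hmax _ (hVup s)) (not_le.2 hlt)

theorem isVSI {g : Metric m} (hg : IsGeneralizedPlaneWave g) : IsVSI g := by
  intro Θ x
  set G := g.toMatrix x with hG
  obtain ⟨A, hA, hmon⟩ := exists_isUnitri_isMonomialOn (g.symm x) (g.nondeg x)
  rw [← hG] at hmon
  have hGdet : G.det ≠ 0 := g.nondeg x
  have hAdet : IsUnit A.det := by rw [hA.det]; exact isUnit_one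
  set B := A⁻¹ with hBdef
  have hBA : B * A = 1 := Matrix.nonsing_inv_mul A hAdet
  have hAB : A * B = 1 := Matrix.mul_nonsing_inv A hAdet
  have hB : IsUnitri B := unitri_inv hAB hBA hA
  set H := A * G * A.transpose with hH
  have hHdet : H.det ≠ 0 := by
    rw [hH, Matrix.det_mul, Matrix.det_mul, Matrix.det_transpose, hA.det]
    simpa using hGdet
  have hHsymm : ∀ i j, H i j = H j i := by
    have : H.IsSymm := by
      unfold Matrix.IsSymm
      rw [hH, Matrix.transpose_mul, Matrix.transpose_mul, Matrix.transpose_transpose,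
        (g.symm x).eq, Matrix.mul_assoc]
    exact fun i j => this.apply j i
  choose σ _ hσ using fun i => hmon i (Finset.mem_univ i)
  have hHσ : ∀ i, H i (σ i) ≠ 0 := by
    intro i h
    refine hHdet (Matrix.det_eq_zero_of_row_eq_zero i fun k => ?_)
    by_cases hk : k = σ i
    · rw [hk, h]
    · exact hσ i k hk
  have hH0 : ∀ i j, H i j ≠ 0 → j = σ i := fun i j h => by
    by_contra hj
    exact h (hσ i j hj)
  have hinv : ∀ i, σ (σ i) = i := fun i => by
    refine (hH0 (σ i) i ?_).symm
    rw [hHsymm]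
    exact hHσ i
  -- The transformed inverse metric is the inverse of the monomial matrix `H`, so it is supported on
  -- the graph of `σ` too.
  set K := B.transpose * G⁻¹ * B with hK
  have hKH : K * H = 1 := by
    have h1 : B * A * G = G := by rw [hBA, one_mul]
    calc K * H = B.transpose * (G⁻¹ * (B * A * G)) * A.transpose := by
          simp only [hK, hH, Matrix.mul_assoc]
      _ = 1 := by
          rw [h1, Matrix.nonsing_inv_mul _ hGdet.isUnit, Matrix.mul_one, ← Matrix.transpose_mul,
            hAB, Matrix.transpose_one]
  have hK0 : ∀ i j, K i j ≠ 0 → j = σ i := by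
    intro i j h
    by_contra hj
    have h1 := congrFun (congrFun hKH i) (σ j)
    rw [Matrix.mul_apply, Finset.sum_eq_single j, Matrix.one_apply_ne] at h1
    · exact (mul_ne_zero h (hHσ j)) h1
    · rintro rfl
      exact hj (hinv j).symm
    · intro k _ hk
      rw [hHsymm, hσ (σ j) k (by rwa [hinv]), mul_zero]
    · simp
  have heval : Θ.eval g x = Θ.contract (fun s I k => nablaR g (Θ.order s) I k x) G⁻¹ G := rfl
  rw [heval, ← Θ.contract_changeBasis _ _ _ hBA]
  have htri : ∀ s I k, changeBasis A B (fun I k => nablaR g (Θ.order s) I k x) I k ≠ 0 →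
      ∀ a, I a < k := fun s I k h a =>
    changeBasis_ne_zero hA hB
      (fun I k a hk => (isTriangular_nablaR hg (Θ.order s) I k).1 ⟨a, hk⟩ x) h a
  refine Θ.contract_eq_zero hinv hK0 hH0 (fun s => Fin.castAdd (Θ.order s) (2 : Fin 3)) htri ?_
  intro s I k h
  set c := Fin.castAdd (Θ.order s) (2 : Fin 3)
  -- As `H` is monomial, each of the two sums reduces to one term. The component with slot `c` set
  -- to `σ k` and upper index `σ (I c)` is therefore nonzero as well, and triangularity applies to
  -- it.
  have hsk := changeBasis_skew (G := G) hBA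
    (fun I l => isSkewAt_nablaR g (Θ.order s) I l x) I (σ k)
  rw [← hH, Finset.sum_eq_single k (fun r _ hr => by rw [hσ (σ k) r (by rwa [hinv]), zero_mul])
    (by simp), Finset.sum_eq_single (σ (I c)) (fun r _ hr => by rw [hσ _ r hr, zero_mul])
    (by simp)] at hsk
  have h1 : H (σ k) k ≠ 0 := by rw [hHsymm]; exact hHσ k
  have h2 : changeBasis A B (fun I k => nablaR g (Θ.order s) I k x)
      (Function.update I c (σ k)) (σ (I c)) ≠ 0 := by
    intro h0
    rw [h0, mul_zero, add_zero] at hsk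
    exact mul_ne_zero h1 h hsk
  simpa using htri s _ _ h2 c

/-! ### Triangular systems of differential equations and geodesics -/

/-- Recursive construction of a family in which the `k`-th member is subject to a condition that
involves only the members before it. -/
theorem exists_triangular_family {α : Type*} (good : α → Prop) (hgood : ∃ a, good a)
    (Rel : Fin m → (Fin m → α) → α → Prop)
    (hloc : ∀ k X Y c, (∀ i, i < k → X i = Y i) → Rel k X c → Rel k Y c)
    (hex : ∀ k X, (∀ i, good (X i)) → ∃ c, good c ∧ Rel k X c) :
    ∃ X : Fin m → α, (∀ k, good (X k)) ∧ ∀ k, Rel k X (X k) := by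
  have key : ∀ n : ℕ, ∃ X : Fin m → α, (∀ k, good (X k)) ∧ ∀ k : Fin m, (k : ℕ) < n →
      Rel k X (X k) := by
    intro n
    induction n with
    | zero =>
      -- Members not yet constructed hold an arbitrary good value, so that `hex` applies to the
      -- whole family at every stage.
      obtain ⟨a, ha⟩ := hgood
      exact ⟨fun _ => a, fun _ => ha, fun k hk => absurd hk (Nat.not_lt_zero _)⟩
    | succ n ih =>
      obtain ⟨X, hX, hR⟩ := ih
      by_cases hn : n < m
      · obtain ⟨c, hc, hcR⟩ := hex ⟨n, hn⟩ X hX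
        have heq : ∀ k : Fin m, (k : ℕ) < n + 1 → ∀ i, i < k →
            X i = Function.update X ⟨n, hn⟩ c i := by
          intro k hk i hi
          rw [Function.update_of_ne]
          rintro rfl
          have : n < (k : ℕ) := hi
          omega
        refine ⟨Function.update X ⟨n, hn⟩ c, fun k => ?_, fun k hk => ?_⟩
        · by_cases hk : k = ⟨n, hn⟩
          · subst hk
            rwa [Function.update_self]
          · rw [Function.update_of_ne hk]
            exact hX k
        · refine hloc k X _ _ (heq k hk) ?_
          by_cases hk' : k = ⟨n, hn⟩
          · subst hk'
            rwa [Function.update_self]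
          · rw [Function.update_of_ne hk']
            refine hR k ?_
            have : (k : ℕ) ≠ n := fun h => hk' (Fin.ext h)
            omega
      · exact ⟨X, hX, fun k _ => hR k (by omega)⟩
  obtain ⟨X, hX, hR⟩ := key m
  exact ⟨X, hX, fun k => hR k k.2⟩

section

variable {s : Set ℝ}

theorem contDiffOn_derivWithin {F : Type*} [NormedAddCommGroup F] [NormedSpace ℝ F] {f : ℝ → F}
    (hu : UniqueDiffOn ℝ s) (hf : ContDiffOn ℝ ∞ f s) : ContDiffOn ℝ ∞ (derivWithin f s) s :=
  ((contDiffOn_infty_iff_derivWithin hu).1 hf).2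

theorem eqOn_of_derivWithin_eqOn {f h : ℝ → ℝ} (hc : Convex ℝ s) (hu : UniqueDiffOn ℝ s)
    (hf : ContDiffOn ℝ ∞ f s) (hh : ContDiffOn ℝ ∞ h s)
    (hd : Set.EqOn (derivWithin f s) (derivWithin h s) s) {t₀ : ℝ} (ht₀ : t₀ ∈ s)
    (h0 : f t₀ = h t₀) : Set.EqOn f h s := by
  refine hc.eqOn_of_fderivWithin_eq (𝕜 := ℝ) (hf.differentiableOn (by simp))
    (hh.differentiableOn (by simp)) hu (fun t ht => ?_) ht₀ h0
  ext
  simpa [derivWithin] using hd ht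

theorem exists_primitive (hcl : IsClosed s) (hu : UniqueDiffOn ℝ s) {f : ℝ → ℝ}
    (hf : ContDiffOn ℝ ∞ f s) (t₀ a : ℝ) :
    ∃ F : ℝ → ℝ, ContDiffOn ℝ ∞ F s ∧ Set.EqOn (derivWithin F s) f s ∧ F t₀ = a := by
  -- Nothing is known about `f` off `s`; a Tietze extension supplies a continuous integrand on `ℝ`.
  obtain ⟨h, hh⟩ := ContinuousMap.exists_restrict_eq hcl ⟨s.domRestrict f, hf.continuousOn.domRestrict⟩
  have hext : ∀ t ∈ s, h t = f t := fun t ht => DFunLike.congr_fun hh ⟨t, ht⟩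
  let F : ℝ → ℝ := fun t => a + ∫ τ in t₀..t, h τ
  have hF : ∀ t ∈ s, HasDerivWithinAt F (f t) s t := by
    intro t ht
    rw [← hext t ht]
    exact ((h.continuous.integral_hasStrictDerivAt t₀ t).hasDerivAt.const_add a).hasDerivWithinAt
  have hd : Set.EqOn (derivWithin F s) f s := fun t ht => (hF t ht).derivWithin (hu t ht)
  refine ⟨F, (contDiffOn_infty_iff_derivWithin hu).2
    ⟨fun t ht => (hF t ht).differentiableWithinAt, hf.congr hd⟩, hd, by simp [F]⟩

theorem exists_second_primitive (hcl : IsClosed s) (hu : UniqueDiffOn ℝ s) {f : ℝ → ℝ}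
    (hf : ContDiffOn ℝ ∞ f s) {t₀ : ℝ} (ht₀ : t₀ ∈ s) (a b : ℝ) :
    ∃ F : ℝ → ℝ, ContDiffOn ℝ ∞ F s ∧ Set.EqOn (derivWithin (derivWithin F s) s) f s ∧
      F t₀ = a ∧ derivWithin F s t₀ = b := by
  obtain ⟨D, hD, hD', hD0⟩ := exists_primitive hcl hu hf t₀ b
  obtain ⟨F, hF, hF', hF0⟩ := exists_primitive hcl hu hD t₀ a
  refine ⟨F, hF, fun t ht => ?_, hF0, by rw [hF' ht₀, hD0]⟩
  rw [derivWithin_congr hF' (hF' ht), hD' ht]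

theorem derivWithin_add_mul_id (hu : UniqueDiffOn ℝ s) {F : ℝ → ℝ} (hF : ContDiffOn ℝ ∞ F s)
    (b : ℝ) : Set.EqOn (derivWithin (fun t => F t + b * t) s) (fun t => derivWithin F s t + b) s := by
  intro t ht
  have h1 := (hF.differentiableOn (by simp) t ht).hasDerivWithinAt
  have h2 : HasDerivWithinAt (fun t : ℝ => b * t) b s t := by
    simpa using (hasDerivWithinAt_id t s).const_mul b
  exact (h1.add h2).derivWithin (hu t ht)

theorem derivWithin_derivWithin_add_mul_id (hu : UniqueDiffOn ℝ s) {F : ℝ → ℝ}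
    (hF : ContDiffOn ℝ ∞ F s) (b : ℝ) :
    Set.EqOn (derivWithin (derivWithin (fun t => F t + b * t) s) s)
      (derivWithin (derivWithin F s) s) s := by
  intro t ht
  have h := derivWithin_add_mul_id hu hF b
  rw [derivWithin_congr h (h ht), derivWithin_add_const]

theorem contDiffOn_add_mul_id {F : ℝ → ℝ} (hF : ContDiffOn ℝ ∞ F s) (b : ℝ) :
    ContDiffOn ℝ ∞ (fun t => F t + b * t) s :=
  hF.add (contDiffOn_const.mul contDiffOn_id)

theorem exists_second_primitive_of_boundary (hcl : IsClosed s) (hu : UniqueDiffOn ℝ s) {f : ℝ → ℝ}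
    (hf : ContDiffOn ℝ ∞ f s) (h0 : (0 : ℝ) ∈ s) (a b : ℝ) :
    ∃ F : ℝ → ℝ, ContDiffOn ℝ ∞ F s ∧ Set.EqOn (derivWithin (derivWithin F s) s) f s ∧
      F 0 = a ∧ F 1 = b := by
  obtain ⟨F, hF, hF', hF0, -⟩ := exists_second_primitive hcl hu hf h0 a 0
  refine ⟨fun t => F t + (b - F 1) * t, contDiffOn_add_mul_id hF _, fun t ht => ?_, ?_, ?_⟩
  · rw [derivWithin_derivWithin_add_mul_id hu hF _ ht, hF' ht]
  · simp [hF0]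
  · simp

theorem eqOn_of_second_derivWithin_eqOn {f h : ℝ → ℝ} (hc : Convex ℝ s) (hu : UniqueDiffOn ℝ s)
    (hf : ContDiffOn ℝ ∞ f s) (hh : ContDiffOn ℝ ∞ h s)
    (hd : Set.EqOn (derivWithin (derivWithin f s) s) (derivWithin (derivWithin h s) s) s) {t₀ : ℝ}
    (ht₀ : t₀ ∈ s) (h0 : f t₀ = h t₀) (h1 : derivWithin f s t₀ = derivWithin h s t₀) :
    Set.EqOn f h s :=
  eqOn_of_derivWithin_eqOn hc hu hf hh
    (eqOn_of_derivWithin_eqOn hc hu (contDiffOn_derivWithin hu hf) (contDiffOn_derivWithin hu hh)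
      hd ht₀ h1) ht₀ h0

/-- Equal second derivatives and equal values at `0` leave a difference `b * t`, and the values at
`1` give `b = 0`. -/
theorem eqOn_of_second_derivWithin_eqOn_of_boundary {f h : ℝ → ℝ} (hc : Convex ℝ s)
    (hu : UniqueDiffOn ℝ s) (hf : ContDiffOn ℝ ∞ f s) (hh : ContDiffOn ℝ ∞ h s)
    (hd : Set.EqOn (derivWithin (derivWithin f s) s) (derivWithin (derivWithin h s) s) s)
    (hs0 : (0 : ℝ) ∈ s) (hs1 : (1 : ℝ) ∈ s) (h0 : f 0 = h 0) (h1 : f 1 = h 1) :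
    Set.EqOn f h s := by
  set b := derivWithin f s 0 - derivWithin h s 0 with hb
  have key : Set.EqOn f (fun t => h t + b * t) s := by
    refine eqOn_of_second_derivWithin_eqOn hc hu hf (contDiffOn_add_mul_id hh b)
      (fun t ht => ?_) hs0 (by simp [h0]) ?_
    · rw [hd ht, derivWithin_derivWithin_add_mul_id hu hh b ht]
    · rw [derivWithin_add_mul_id hu hh b hs0, hb]
      ring
  have hb0 : b = 0 := by
    have := key hs1
    simp only [mul_one] at this
    linarith
  intro t ht
  have := key ht
  simpa [hb0] using this

theorem contDiffOn_component {X : ℝ → E m} (hX : ContDiffOn ℝ ∞ X s) (k : Fin m) :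
    ContDiffOn ℝ ∞ (fun t => X t k) s := contDiffOn_pi.1 hX k

theorem derivWithin_component {X : ℝ → E m} (hX : ContDiffOn ℝ ∞ X s) {t : ℝ} (ht : t ∈ s)
    (k : Fin m) : derivWithin X s t k = derivWithin (fun τ => X τ k) s t := by
  rw [derivWithin_pi fun i => (contDiffOn_component hX i).differentiableOn (by simp) t ht]

/-- The geodesic equation in components. -/
theorem isGeodesicOn_iff (g : Metric m) (hu : UniqueDiffOn ℝ s) (γ : ℝ → E m) :
    IsGeodesicOn g γ s ↔ (∀ k, ContDiffOn ℝ ∞ (fun t => γ t k) s) ∧ ∀ k, ∀ t ∈ s,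
      derivWithin (derivWithin (fun τ => γ τ k) s) s t = -∑ i, ∑ j, christoffel g i j k (γ t) *
        derivWithin (fun τ => γ τ i) s t * derivWithin (fun τ => γ τ j) s t := by
  unfold IsGeodesicOn
  rw [contDiffOn_pi]
  refine and_congr_right fun hγ => ?_
  have hγ' : ContDiffOn ℝ ∞ γ s := contDiffOn_pi.2 hγ
  have hcomp : ∀ k, ∀ t ∈ s, derivWithin γ s t k = derivWithin (fun τ => γ τ k) s t :=
    fun k t ht => derivWithin_component hγ' ht k
  have hcomp2 : ∀ k, ∀ t ∈ s, derivWithin (derivWithin γ s) s t k =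
      derivWithin (derivWithin (fun τ => γ τ k) s) s t := by
    intro k t ht
    rw [derivWithin_component (contDiffOn_derivWithin hu hγ') ht k]
    exact derivWithin_congr (hcomp k) (hcomp k t ht)
  have key : ∀ k, ∀ t ∈ s, (covDerivAlong g γ (derivWithin γ s) s t k = 0 ↔
      derivWithin (derivWithin (fun τ => γ τ k) s) s t = -∑ i, ∑ j, christoffel g i j k (γ t) *
        derivWithin (fun τ => γ τ i) s t * derivWithin (fun τ => γ τ j) s t) := by
    intro k t ht
    unfold covDerivAlong
    rw [hcomp2 k t ht]
    simp only [hcomp _ t ht]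
    exact add_eq_zero_iff_eq_neg
  constructor
  · intro h k t ht
    exact (key k t ht).1 (congrFun (h t ht) k)
  · intro h t ht
    funext k
    exact (key k t ht).2 (h k t ht)

theorem isParallelOn_iff (g : Metric m) (γ X : ℝ → E m) :
    IsParallelOn g γ X s ↔ (∀ k, ContDiffOn ℝ ∞ (fun t => X t k) s) ∧ ∀ k, ∀ t ∈ s,
      derivWithin (fun τ => X τ k) s t = -∑ i, ∑ j, christoffel g i j k (γ t) *
        derivWithin γ s t i * X t j := by
  unfold IsParallelOn
  rw [contDiffOn_pi]
  refine and_congr_right fun hX => ?_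
  have key : ∀ k, ∀ t ∈ s, (covDerivAlong g γ X s t k = 0 ↔
      derivWithin (fun τ => X τ k) s t = -∑ i, ∑ j, christoffel g i j k (γ t) *
        derivWithin γ s t i * X t j) := by
    intro k t ht
    unfold covDerivAlong
    rw [derivWithin_component (contDiffOn_pi.2 hX) ht k]
    exact add_eq_zero_iff_eq_neg
  constructor
  · intro h k t ht
    exact (key k t ht).1 (congrFun (h t ht) k)
  · intro h t ht
    funext k
    exact (key k t ht).2 (h k t ht)

theorem contDiffOn_christoffel_comp (g : Metric m) {γ : ℝ → E m} (hγ : ContDiffOn ℝ ∞ γ s)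
    (i j k : Fin m) : ContDiffOn ℝ ∞ (fun t => christoffel g i j k (γ t)) s :=
  (contDiff_christoffel g i j k).comp_contDiffOn hγ

/-- Geodesics with componentwise boundary conditions that are solvable for `c'' = f`. -/
theorem exists_isGeodesicOn {g : Metric m} (hg : IsGeneralizedPlaneWave g)
    (hu : UniqueDiffOn ℝ s) (BC : Fin m → (ℝ → ℝ) → Prop)
    (hBC : ∀ k f, ContDiffOn ℝ ∞ f s → ∃ c, ContDiffOn ℝ ∞ c s ∧
      Set.EqOn (derivWithin (derivWithin c s) s) f s ∧ BC k c) :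
    ∃ γ : ℝ → E m, IsGeodesicOn g γ s ∧ ∀ k, BC k (fun t => γ t k) := by
  let rhs : Fin m → (Fin m → ℝ → ℝ) → ℝ → ℝ := fun k X t =>
    -∑ i, ∑ j, christoffel g i j k (fun a => X a t) * derivWithin (X i) s t * derivWithin (X j) s t
  obtain ⟨X, hX, hR⟩ := exists_triangular_family (m := m) (fun c : ℝ → ℝ => ContDiffOn ℝ ∞ c s)
    ⟨fun _ => 0, contDiffOn_const⟩
    (fun k X c => Set.EqOn (derivWithin (derivWithin c s) s) (rhs k X) s ∧ BC k c)
    (fun k X Y c hXY ⟨h1, h2⟩ => by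
      refine ⟨fun t ht => ?_, h2⟩
      rw [h1 ht]
      simp only [rhs]
      refine congrArg _ (Finset.sum_congr rfl fun i _ => Finset.sum_congr rfl fun j _ => ?_)
      -- Only `i, j < k` contribute, and their symbols depend only on coordinates before `k`: the
      -- right-hand side is known before the `k`-th component.
      by_cases hij : k ≤ i ∨ k ≤ j
      · rw [hg.christoffel_eq_zero hij, hg.christoffel_eq_zero hij]
        simp
      · push Not at hij
        rw [hXY i hij.1, hXY j hij.2, (hg i j k).2 (fun a => X a t) (fun a => Y a t)
          fun a ha => by rw [hXY a ha]])
    (fun k X hX => by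
      refine hBC k _ (ContDiffOn.neg (ContDiffOn.sum fun i _ => ContDiffOn.sum fun j _ => ?_))
      exact ((contDiffOn_christoffel_comp g (contDiffOn_pi.2 hX) i j k).mul
        (contDiffOn_derivWithin hu (hX i))).mul (contDiffOn_derivWithin hu (hX j)))
  exact ⟨fun t k => X k t, (isGeodesicOn_iff g hu _).2 ⟨hX, fun k t ht => (hR k).1 ht⟩,
    fun k => (hR k).2⟩

/-- Induction on the component. The scalar uniqueness statement is left as the hypothesis `huniq`,
so that initial and endpoint conditions are treated alike. -/
theorem IsGeodesicOn.eqOn {g : Metric m} (hg : IsGeneralizedPlaneWave g) (hu : UniqueDiffOn ℝ s)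
    {γ γ' : ℝ → E m} (hγ : IsGeodesicOn g γ s) (hγ' : IsGeodesicOn g γ' s)
    (huniq : ∀ k, Set.EqOn (derivWithin (derivWithin (fun t => γ t k) s) s)
      (derivWithin (derivWithin (fun t => γ' t k) s) s) s →
        Set.EqOn (fun t => γ t k) (fun t => γ' t k) s) : Set.EqOn γ γ' s := by
  have h1 := ((isGeodesicOn_iff g hu _).1 hγ).2
  have h2 := ((isGeodesicOn_iff g hu _).1 hγ').2
  have key : ∀ k : Fin m, Set.EqOn (fun t => γ t k) (fun t => γ' t k) s := by
    intro k
    induction k using WellFoundedLT.induction with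
    | _ k ih =>
      refine huniq k fun t ht => ?_
      rw [h1 k t ht, h2 k t ht]
      refine congrArg _ (Finset.sum_congr rfl fun i _ => Finset.sum_congr rfl fun j _ => ?_)
      by_cases hij : k ≤ i ∨ k ≤ j
      · rw [hg.christoffel_eq_zero hij, hg.christoffel_eq_zero hij]
        simp
      · push Not at hij
        rw [derivWithin_congr (ih i hij.1) (ih i hij.1 ht),
          derivWithin_congr (ih j hij.2) (ih j hij.2 ht),
          (hg i j k).2 (γ t) (γ' t) fun a ha => ih a ha ht]
  exact fun t ht => funext fun k => key k ht

theorem IsGeodesicOn.mono_univ {g : Metric m} (hu : UniqueDiffOn ℝ s) {γ : ℝ → E m}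
    (hγ : IsGeodesicOn g γ Set.univ) : IsGeodesicOn g γ s := by
  have hs : ContDiff ℝ ∞ γ := contDiffOn_univ.1 hγ.1
  have h1 : Set.EqOn (derivWithin γ s) (derivWithin γ Set.univ) s := fun t ht => by
    rw [derivWithin_univ]
    exact (hs.differentiable (by simp) t).derivWithin (hu t ht)
  have hs' : ContDiffOn ℝ ∞ (derivWithin γ Set.univ) Set.univ :=
    contDiffOn_derivWithin uniqueDiffOn_univ hγ.1
  refine ⟨hs.contDiffOn, fun t ht => ?_⟩
  have h2 : derivWithin (derivWithin γ s) s t =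
      derivWithin (derivWithin γ Set.univ) Set.univ t := by
    rw [derivWithin_congr h1 (h1 ht), derivWithin_univ (f := derivWithin γ Set.univ)]
    exact ((contDiffOn_univ.1 hs').differentiable (by simp) t).derivWithin (hu t ht)
  rw [← hγ.2 t (Set.mem_univ t)]
  unfold covDerivAlong
  rw [h2, h1 ht]

end

theorem isComplete {g : Metric m} (hg : IsGeneralizedPlaneWave g) : IsComplete g := by
  intro I γ hI hIc hγ
  have hu : UniqueDiffOn ℝ I := hI.uniqueDiffOn
  rcases I.eq_empty_or_nonempty with rfl | ⟨t₀, ht₀⟩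
  -- An empty interval still asks for some geodesic on `ℝ`.
  · obtain ⟨γ', h, -⟩ := exists_isGeodesicOn hg (s := Set.univ) uniqueDiffOn_univ (fun _ _ => True)
      (fun k f hf => by
        obtain ⟨F, hF, hF', -⟩ := exists_second_primitive isClosed_univ uniqueDiffOn_univ hf
          (Set.mem_univ 0) 0 0
        exact ⟨F, hF, hF', trivial⟩)
    exact ⟨γ', h, Set.eqOn_empty _ _⟩
  -- The extension is the geodesic on `ℝ` with the position and velocity of `γ` at `t₀`.
  · obtain ⟨γ', h, h'⟩ := exists_isGeodesicOn hg (s := Set.univ) uniqueDiffOn_univ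
      (fun k c => c t₀ = γ t₀ k ∧ derivWithin c Set.univ t₀ = derivWithin (fun t => γ t k) I t₀)
      (fun k f hf => exists_second_primitive isClosed_univ uniqueDiffOn_univ hf (Set.mem_univ t₀)
        _ _)
    have hr : IsGeodesicOn g γ' I := h.mono_univ hu
    refine ⟨γ', h, hγ.eqOn hg hu hr fun k hk => ?_⟩
    refine eqOn_of_second_derivWithin_eqOn hIc.convex hu (contDiffOn_component hγ.1 k)
      (contDiffOn_component hr.1 k) hk ht₀ (h' k).1.symm ?_
    rw [← (h' k).2, derivWithin_univ]
    have hs := contDiffOn_univ.1 (contDiffOn_component h.1 k)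
    exact ((hs.differentiable (by simp) t₀).derivWithin (hu t₀ ht₀)).symm

theorem isStronglyGeodesicallyConvex {g : Metric m} (hg : IsGeneralizedPlaneWave g) :
    IsStronglyGeodesicallyConvex g := by
  intro P Q
  have hu : UniqueDiffOn ℝ (Set.Icc (0 : ℝ) 1) := uniqueDiffOn_Icc zero_lt_one
  have h0 : (0 : ℝ) ∈ Set.Icc (0 : ℝ) 1 := Set.left_mem_Icc.2 zero_le_one
  have h1 : (1 : ℝ) ∈ Set.Icc (0 : ℝ) 1 := Set.right_mem_Icc.2 zero_le_one
  obtain ⟨γ, h, h'⟩ := exists_isGeodesicOn hg (s := Set.Icc 0 1) hu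
    (fun k c => c 0 = P k ∧ c 1 = Q k)
    (fun k f hf => exists_second_primitive_of_boundary isClosed_Icc hu hf h0 _ _)
  refine ⟨γ, ⟨h, funext fun k => (h' k).1, funext fun k => (h' k).2⟩, fun γ' hγ' hP hQ => ?_⟩
  refine hγ'.eqOn hg hu h fun k hk => ?_
  refine eqOn_of_second_derivWithin_eqOn_of_boundary (convex_Icc 0 1) hu
    (contDiffOn_component hγ'.1 k) (contDiffOn_component h.1 k) hk h0 h1 ?_ ?_
  · rw [hP]
    exact (h' k).1.symm
  · rw [hQ]
    exact (h' k).2.symm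

/-! ### Parallel transport -/

section

variable {s : Set ℝ}

/-- The curve is given, so only the components of the field with index below `k` must be known
before the `k`-th one is found by integration. -/
theorem exists_isParallelOn {g : Metric m} (hg : IsGeneralizedPlaneWave g) (hcl : IsClosed s)
    (hu : UniqueDiffOn ℝ s) {γ : ℝ → E m} (hγ : ContDiffOn ℝ ∞ γ s) (t₀ : ℝ) (v : E m) :
    ∃ X : ℝ → E m, IsParallelOn g γ X s ∧ X t₀ = v := by
  let rhs : Fin m → (Fin m → ℝ → ℝ) → ℝ → ℝ := fun k X t =>
    -∑ i, ∑ j, christoffel g i j k (γ t) * derivWithin γ s t i * X j t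
  obtain ⟨X, hX, hR⟩ := exists_triangular_family (m := m) (fun c : ℝ → ℝ => ContDiffOn ℝ ∞ c s)
    ⟨fun _ => 0, contDiffOn_const⟩
    (fun k X c => Set.EqOn (derivWithin c s) (rhs k X) s ∧ c t₀ = v k)
    (fun k X Y c hXY ⟨h1, h2⟩ => by
      refine ⟨fun t ht => ?_, h2⟩
      rw [h1 ht]
      simp only [rhs]
      refine congrArg _ (Finset.sum_congr rfl fun i _ => Finset.sum_congr rfl fun j _ => ?_)
      by_cases hj : k ≤ j
      · rw [hg.christoffel_eq_zero (Or.inr hj)]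
        simp
      · rw [hXY j (not_le.1 hj)])
    (fun k X hX => by
      refine exists_primitive hcl hu
        (ContDiffOn.neg (ContDiffOn.sum fun i _ => ContDiffOn.sum fun j _ => ?_)) t₀ (v k)
      exact ((contDiffOn_christoffel_comp g hγ i j k).mul
        (contDiffOn_component (contDiffOn_derivWithin hu hγ) i)).mul (hX j))
  exact ⟨fun t k => X k t, (isParallelOn_iff g γ _).2 ⟨hX, fun k t ht => (hR k).1 ht⟩,
    funext fun k => (hR k).2⟩

theorem IsParallelOn.eqOn {g : Metric m} (hg : IsGeneralizedPlaneWave g) (hc : Convex ℝ s)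
    (hu : UniqueDiffOn ℝ s) {γ X Y : ℝ → E m} (hX : IsParallelOn g γ X s)
    (hY : IsParallelOn g γ Y s) {t₀ : ℝ} (ht₀ : t₀ ∈ s) (h0 : X t₀ = Y t₀) : Set.EqOn X Y s := by
  obtain ⟨h1, h1'⟩ := (isParallelOn_iff g γ X).1 hX
  obtain ⟨h2, h2'⟩ := (isParallelOn_iff g γ Y).1 hY
  have key : ∀ k : Fin m, Set.EqOn (fun t => X t k) (fun t => Y t k) s := by
    intro k
    induction k using WellFoundedLT.induction with
    | _ k ih =>
      refine eqOn_of_derivWithin_eqOn hc hu (h1 k) (h2 k) (fun t ht => ?_) ht₀ (congrFun h0 k)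
      rw [h1' k t ht, h2' k t ht]
      refine congrArg _ (Finset.sum_congr rfl fun i _ => Finset.sum_congr rfl fun j _ => ?_)
      by_cases hj : k ≤ j
      · rw [hg.christoffel_eq_zero (Or.inr hj)]
        simp
      · have : X t j = Y t j := ih j (not_le.1 hj) ht
        rw [this]
  exact fun t ht => funext fun k => key k ht

theorem IsParallelOn.add {g : Metric m} {γ X Y : ℝ → E m} (hX : IsParallelOn g γ X s)
    (hY : IsParallelOn g γ Y s) : IsParallelOn g γ (fun t => X t + Y t) s := by
  obtain ⟨h1, h1'⟩ := (isParallelOn_iff g γ X).1 hX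
  obtain ⟨h2, h2'⟩ := (isParallelOn_iff g γ Y).1 hY
  refine (isParallelOn_iff g γ _).2 ⟨fun k => (h1 k).add (h2 k), fun k t ht => ?_⟩
  simp only [Pi.add_apply]
  rw [derivWithin_fun_add ((h1 k).differentiableOn (by simp) t ht)
    ((h2 k).differentiableOn (by simp) t ht), h1' k t ht, h2' k t ht]
  simp only [mul_add, Finset.sum_add_distrib]
  ring

theorem IsParallelOn.const_smul {g : Metric m} {γ X : ℝ → E m} (hX : IsParallelOn g γ X s)
    (c : ℝ) : IsParallelOn g γ (fun t => c • X t) s := by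
  obtain ⟨h1, h1'⟩ := (isParallelOn_iff g γ X).1 hX
  refine (isParallelOn_iff g γ _).2 ⟨fun k => contDiffOn_const.mul (h1 k), fun k t ht => ?_⟩
  simp only [Pi.smul_apply, smul_eq_mul]
  rw [derivWithin_const_mul c ((h1 k).differentiableOn (by simp) t ht), h1' k t ht, mul_neg,
    Finset.mul_sum]
  simp only [Finset.mul_sum]
  refine congrArg _ (Finset.sum_congr rfl fun i _ => Finset.sum_congr rfl fun j _ => ?_)
  ring

/-- Up to the index `i`, the components of a parallel field that starts as `∂_i` are constant. -/
theorem IsParallelOn.apply_eq_basisVec {g : Metric m} (hg : IsGeneralizedPlaneWave g)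
    (hc : Convex ℝ s) (hu : UniqueDiffOn ℝ s) {γ X : ℝ → E m} (hX : IsParallelOn g γ X s) {t₀ : ℝ}
    (ht₀ : t₀ ∈ s) {i : Fin m} (h0 : X t₀ = basisVec i) (k : Fin m) (hk : k ≤ i) :
    ∀ t ∈ s, X t k = basisVec i k := by
  obtain ⟨h1, h1'⟩ := (isParallelOn_iff g γ X).1 hX
  induction k using WellFoundedLT.induction with
  | _ k ih =>
    refine eqOn_of_derivWithin_eqOn (h := fun _ => basisVec i k) hc hu (h1 k) contDiffOn_const
      (fun t ht => ?_) ht₀ (congrFun h0 k)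
    rw [h1' k t ht, derivWithin_fun_const, Pi.zero_apply, neg_eq_zero]
    refine Finset.sum_eq_zero fun a _ => Finset.sum_eq_zero fun j _ => ?_
    by_cases hj : k ≤ j
    · rw [hg.christoffel_eq_zero (Or.inr hj)]
      simp
    · rw [ih j (not_le.1 hj) ((not_le.1 hj).le.trans hk) t ht, basisVec,
        Pi.single_eq_of_ne (lt_of_lt_of_le (not_le.1 hj) hk).ne, mul_zero]

end

/-- Uniqueness from the parameter `0` makes transport well defined and linear. Uniqueness from the
parameter `1` makes it injective, hence bijective in finite dimension. -/
theorem exists_isParallelTransport {g : Metric m} (hg : IsGeneralizedPlaneWave g) {γ : ℝ → E m}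
    (hγ : IsSmoothCurve γ) : ∃ P : E m ≃ₗ[ℝ] E m, IsParallelTransport g γ P := by
  have hu : UniqueDiffOn ℝ (Set.Icc (0 : ℝ) 1) := uniqueDiffOn_Icc zero_lt_one
  have h0 : (0 : ℝ) ∈ Set.Icc (0 : ℝ) 1 := Set.left_mem_Icc.2 zero_le_one
  have h1 : (1 : ℝ) ∈ Set.Icc (0 : ℝ) 1 := Set.right_mem_Icc.2 zero_le_one
  have hc : Convex ℝ (Set.Icc (0 : ℝ) 1) := convex_Icc 0 1
  choose X hX hX0 using fun v => exists_isParallelOn hg isClosed_Icc hu hγ 0 v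
  have huniq : ∀ v Y, IsParallelOn g γ Y (Set.Icc 0 1) → Y 0 = v → X v 1 = Y 1 :=
    fun v Y hY hY0 => (hX v).eqOn hg hc hu hY h0 ((hX0 v).trans hY0.symm) h1
  let L : E m →ₗ[ℝ] E m :=
    { toFun := fun v => X v 1
      map_add' := fun v w => huniq _ _ ((hX v).add (hX w)) (by rw [hX0, hX0])
      map_smul' := fun c v => huniq _ _ ((hX v).const_smul c) (by rw [hX0]) }
  have hinj : Function.Injective L := by
    intro v w hvw
    have := (hX v).eqOn hg hc hu (hX w) h1 hvw h0
    rwa [hX0, hX0] at this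
  refine ⟨LinearEquiv.ofInjectiveEndo L hinj, fun v w => ?_⟩
  change _ ↔ X v 1 = w
  constructor
  · rintro ⟨Y, hY, hY0, hY1⟩
    rw [huniq v Y hY hY0, hY1]
  · intro h
    exact ⟨X v, hX v, hX0 v, h⟩

theorem sum_smul_basisVec (v : E m) : ∑ j, v j • basisVec j = v := by
  funext k
  simp [basisVec, Pi.single_apply]

theorem IsParallelTransport.apply_basisVec {g : Metric m} (hg : IsGeneralizedPlaneWave g)
    {γ : ℝ → E m} {P : E m ≃ₗ[ℝ] E m} (hP : IsParallelTransport g γ P) (i k : Fin m)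
    (hk : k ≤ i) : P (basisVec i) k = basisVec i k := by
  obtain ⟨X, hX, hX0, hX1⟩ := (hP (basisVec i) _).2 rfl
  rw [← hX1]
  exact hX.apply_eq_basisVec hg (convex_Icc 0 1) (uniqueDiffOn_Icc zero_lt_one)
    (Set.left_mem_Icc.2 zero_le_one) hX0 k hk 1 (Set.right_mem_Icc.2 zero_le_one)

theorem IsParallelTransport.exists_coeff {g : Metric m} (hg : IsGeneralizedPlaneWave g)
    {γ : ℝ → E m} {P : E m ≃ₗ[ℝ] E m} (hP : IsParallelTransport g γ P) (i : Fin m) :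
    ∃ a : Fin m → ℝ, P (basisVec i) = basisVec i + ∑ j ∈ Finset.Ioi i, a j • basisVec j := by
  refine ⟨P (basisVec i), funext fun k => ?_⟩
  have hsum : (∑ j ∈ Finset.Ioi i, P (basisVec i) j • basisVec j) k =
      if i < k then P (basisVec i) k else 0 := by
    simp [Finset.sum_apply, basisVec, Pi.single_apply]
  rw [Pi.add_apply, hsum]
  by_cases hk : i < k
  · rw [if_pos hk, basisVec, Pi.single_eq_of_ne hk.ne', zero_add]
  · rw [if_neg hk, add_zero, hP.apply_basisVec hg i k (not_lt.1 hk)]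

/-! ### The unipotent group and holonomy -/

/-- All entries with column index less than the row index plus `n` vanish. -/
def IsUpperShift (n : ℕ) (A : Matrix (Fin m) (Fin m) ℝ) : Prop :=
  ∀ i j : Fin m, (j : ℕ) < i + n → A i j = 0

theorem IsUpperShift.mul {a b : ℕ} {A B : Matrix (Fin m) (Fin m) ℝ} (hA : IsUpperShift a A)
    (hB : IsUpperShift b B) : IsUpperShift (a + b) (A * B) := by
  intro i j h
  rw [Matrix.mul_apply]
  refine Finset.sum_eq_zero fun k _ => ?_
  by_cases hk : (k : ℕ) < i + a
  · rw [hA i k hk, zero_mul]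
  · rw [hB k j (by omega), mul_zero]

theorem IsUpperShift.add {a : ℕ} {A B : Matrix (Fin m) (Fin m) ℝ} (hA : IsUpperShift a A)
    (hB : IsUpperShift a B) : IsUpperShift a (A + B) := fun i j h => by
  rw [Matrix.add_apply, hA i j h, hB i j h, add_zero]

theorem IsUpperShift.sub {a : ℕ} {A B : Matrix (Fin m) (Fin m) ℝ} (hA : IsUpperShift a A)
    (hB : IsUpperShift a B) : IsUpperShift a (A - B) := fun i j h => by
  rw [Matrix.sub_apply, hA i j h, hB i j h, sub_zero]

theorem isUpperShift_zero_of_mem (A : upperUnipotent m) : IsUpperShift 0 A.val.val :=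
  fun i j h => A.2.1 i j h

theorem isUpperShift_one_of_mem (A : upperUnipotent m) : IsUpperShift 1 (A.val.val - 1) := by
  intro i j h
  rcases lt_or_eq_of_le (show j ≤ i from Nat.lt_succ_iff.1 h) with h | rfl
  · rw [Matrix.sub_apply, A.2.1 i j h, Matrix.one_apply_ne h.ne', sub_zero]
  · rw [Matrix.sub_apply, A.2.2 j, Matrix.one_apply_eq, sub_self]

/-- The subgroup of the matrices that differ from `1` only from the `n`-th superdiagonal on. -/
def superdiagonalSubgroup (m n : ℕ) : Subgroup (upperUnipotent m) where
  carrier := {A | IsUpperShift n (A.val.val - 1)}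
  mul_mem' := fun {A B} hA hB => by
    have h : (A * B).val.val - 1 = (A.val.val - 1) * B.val.val + (B.val.val - 1) := by
      change A.val.val * B.val.val - 1 = _
      rw [sub_mul, one_mul]
      abel
    change IsUpperShift n ((A * B).val.val - 1)
    rw [h]
    exact (hA.mul (isUpperShift_zero_of_mem B)).add hB
  one_mem' := by
    change IsUpperShift n ((1 : Matrix (Fin m) (Fin m) ℝ) - 1)
    rw [sub_self]
    exact fun _ _ _ => rfl
  inv_mem' := fun {A} hA => by
    have h : (A⁻¹).val.val - 1 = 0 - (A⁻¹).val.val * (A.val.val - 1) := by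
      have : (A⁻¹).val.val * A.val.val = 1 := A.val.inv_val
      rw [mul_sub, this, mul_one]
      abel
    change IsUpperShift n ((A⁻¹).val.val - 1)
    rw [h]
    refine IsUpperShift.sub (fun _ _ _ => rfl) ?_
    have := (isUpperShift_zero_of_mem A⁻¹).mul hA
    rwa [zero_add] at this

/-- The subgroups `superdiagonalSubgroup m n` form a descending central series: `A * B * A⁻¹ * B⁻¹ -
1` is the commutator of `A - 1` and `B - 1` times a unitriangular matrix, so it starts one
superdiagonal further out than `A - 1`. -/
theorem isNilpotent_upperUnipotent (m : ℕ) : Group.IsNilpotent (upperUnipotent m) := by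
  rw [Subgroup.nilpotent_iff_finite_descending_central_series]
  refine ⟨m, superdiagonalSubgroup m, ⟨?_, fun A n hA B => ?_⟩, ?_⟩
  · refine eq_top_iff.2 fun A _ => ?_
    exact fun i j h => isUpperShift_one_of_mem A i j (by omega)
  · change IsUpperShift (n + 1) ((A * B * A⁻¹ * B⁻¹).val.val - 1)
    have h : (A * B * A⁻¹ * B⁻¹).val.val - 1 =
        ((A.val.val - 1) * (B.val.val - 1) - (B.val.val - 1) * (A.val.val - 1)) *
          (A⁻¹ * B⁻¹).val.val := by
      have h1 : (A.val.val - 1) * (B.val.val - 1) - (B.val.val - 1) * (A.val.val - 1) =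
          (A * B).val.val - (B * A).val.val := by
        change _ = A.val.val * B.val.val - B.val.val * A.val.val
        noncomm_ring
      have h2 : ∀ C D : upperUnipotent m, C.val.val * D.val.val = (C * D).val.val :=
        fun _ _ => rfl
      rw [h1, sub_mul, h2, h2]
      have h3 : B * A * (A⁻¹ * B⁻¹) = 1 := by group
      have h4 : A * B * (A⁻¹ * B⁻¹) = A * B * A⁻¹ * B⁻¹ := by group
      rw [h3, h4]
      rfl
    rw [h]
    have hB := isUpperShift_one_of_mem B
    have h5 := ((hA.mul hB).sub (by rw [add_comm n 1]; exact hB.mul hA)).mul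
      (isUpperShift_zero_of_mem (A⁻¹ * B⁻¹))
    rwa [add_zero] at h5
  · refine eq_bot_iff.2 fun A hA => ?_
    have h : A.val.val - 1 = 0 := by
      ext i j
      exact hA i j (by omega)
    exact Subgroup.mem_bot.2 (Subtype.ext (Units.ext (sub_eq_zero.1 h)))

/-- The matrix `T` with `A ∂_i = ∑ j, T i j • ∂_j`. -/
def rowMatrix (A : E m ≃ₗ[ℝ] E m) : Matrix (Fin m) (Fin m) ℝ :=
  Matrix.of fun i j => A (basisVec i) j

theorem apply_basisVec_eq_sum (A : E m ≃ₗ[ℝ] E m) (i : Fin m) :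
    A (basisVec i) = ∑ j, rowMatrix A i j • basisVec j :=
  (sum_smul_basisVec (A (basisVec i))).symm

/-- Images of basis vectors are rows, so products are reversed. This does no harm to membership in a
subgroup. -/
theorem rowMatrix_mul (A B : E m ≃ₗ[ℝ] E m) : rowMatrix (A * B) = rowMatrix B * rowMatrix A := by
  ext i j
  change A (B (basisVec i)) j = _
  rw [apply_basisVec_eq_sum B i, map_sum, Finset.sum_apply, Matrix.mul_apply]
  exact Finset.sum_congr rfl fun k _ => by rw [map_smul]; rfl

theorem rowMatrix_one : rowMatrix (1 : E m ≃ₗ[ℝ] E m) = 1 := by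
  ext i j
  change (Pi.single i 1 : E m) j = _
  rw [Pi.single_apply, Matrix.one_apply]
  simp only [eq_comm]

theorem rowMatrix_mul_rowMatrix_inv (A : E m ≃ₗ[ℝ] E m) : rowMatrix A * rowMatrix A⁻¹ = 1 := by
  rw [← rowMatrix_mul, inv_mul_cancel, rowMatrix_one]

theorem rowMatrix_inv_mul_rowMatrix (A : E m ≃ₗ[ℝ] E m) : rowMatrix A⁻¹ * rowMatrix A = 1 := by
  rw [← rowMatrix_mul, mul_inv_cancel, rowMatrix_one]

theorem IsParallelTransport.isUnitri_rowMatrix {g : Metric m} (hg : IsGeneralizedPlaneWave g)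
    {γ : ℝ → E m} {P : E m ≃ₗ[ℝ] E m} (hP : IsParallelTransport g γ P) :
    IsUnitri (rowMatrix P) := by
  refine ⟨fun i j h => ?_, fun i => ?_⟩
  · change P (basisVec i) j = 0
    rw [hP.apply_basisVec hg i j h.le, basisVec, Pi.single_eq_of_ne h.ne]
  · change P (basisVec i) i = 1
    rw [hP.apply_basisVec hg i i le_rfl, basisVec, Pi.single_eq_same]

theorem exists_mem_upperUnipotent {g : Metric m} (hg : IsGeneralizedPlaneWave g) (p : E m)
    {A : E m ≃ₗ[ℝ] E m} (hA : A ∈ holonomyGroup g p) :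
    ∃ T ∈ upperUnipotent m, ∀ i : Fin m, A (basisVec i) = ∑ j, T.val i j • basisVec j := by
  have key : IsUnitri (rowMatrix A) := by
    induction hA using Subgroup.closure_induction with
    | mem P hP =>
      obtain ⟨γ, -, -, -, hP⟩ := hP
      exact hP.isUnitri_rowMatrix hg
    | one =>
      rw [rowMatrix_one]
      exact isUnitri_one
    | mul A B _ _ hA hB =>
      rw [rowMatrix_mul]
      exact unitri_mul hB hA
    | inv A _ hA =>
      exact unitri_inv (rowMatrix_mul_rowMatrix_inv A) (rowMatrix_inv_mul_rowMatrix A) hA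
  exact ⟨⟨rowMatrix A, rowMatrix A⁻¹, rowMatrix_mul_rowMatrix_inv A,
    rowMatrix_inv_mul_rowMatrix A⟩, key, apply_basisVec_eq_sum A⟩

end GPW

theorem theorem1p1 (m : ℕ) (g : GPW.Metric m) (hg : GPW.IsGeneralizedPlaneWave g) :
    (GPW.IsComplete g ∧ GPW.IsStronglyGeodesicallyConvex g) ∧
    (∀ (ν : ℕ) (I : Fin (3 + ν) → Fin m) (k : Fin m),
      ((∃ a, k ≤ I a) → ∀ x, GPW.nablaR g ν I k x = 0) ∧
      GPW.DependsOnlyBelow k (GPW.nablaR g ν I k)) ∧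
    (GPW.IsNilpotentOsserman g ∧ GPW.IsNilpotentIvanovPetrova g ∧ GPW.IsNilpotentSzabo g) ∧
    (GPW.IsRicciFlat g ∧ GPW.IsEinstein g) ∧
    GPW.IsVSI g ∧
    (∀ γ : ℝ → GPW.E m, GPW.IsSmoothCurve γ →
      ∃ P : GPW.E m ≃ₗ[ℝ] GPW.E m, GPW.IsParallelTransport g γ P ∧
        ∀ i : Fin m, ∃ a : Fin m → ℝ,
          P (GPW.basisVec i) = GPW.basisVec i + ∑ j ∈ Finset.Ioi i, a j • GPW.basisVec j) ∧
    (Group.IsNilpotent (GPW.upperUnipotent m) ∧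
      ∀ (p : GPW.E m), ∀ A ∈ GPW.holonomyGroup g p, ∃ T ∈ GPW.upperUnipotent m,
        ∀ i : Fin m, A (GPW.basisVec i) = ∑ j, T.val i j • GPW.basisVec j) := by
  exact ⟨⟨GPW.isComplete hg, GPW.isStronglyGeodesicallyConvex hg⟩,
    fun ν I k => GPW.isTriangular_nablaR hg ν I k,
    ⟨GPW.isNilpotentOsserman hg, GPW.isNilpotentIvanovPetrova hg, GPW.isNilpotentSzabo hg⟩,
    ⟨GPW.isRicciFlat hg, GPW.isEinstein hg⟩, GPW.isVSI hg,
    fun γ hγ => by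
      obtain ⟨P, hP⟩ := GPW.exists_isParallelTransport hg hγ
      exact ⟨P, hP, hP.exists_coeff hg⟩,
    GPW.isNilpotent_upperUnipotent m, fun p _ hA => GPW.exists_mem_upperUnipotent hg p hA⟩
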